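/- Let $\mathfrak H$ and $\mathfrak H_n$, $n\in\mathbb N$, be separable complex Hilbert spaces, let $J_n:\mathfrak H\to\mathfrak H_n$ be bounded linear operators, and let $A$ in $\mathfrak H$ and $A_n$ in $\mathfrak H_n$ be (possibly unbounded) self-adjoint operators. Write $R_T(z)=(T-z)^{-1}$ for the resolvent, $P_T(\Omega)$ for the spectral projections of a self-adjoint operator $T$, and $\Gamma=\mathbb C\setminus\overline{\sigma(A)\cup\bigcup_n\sigma(A_n)}$. Let $\sigma_{ess}(A)$ be $\sigma(A)$ without the isolated points of $\sigma(A)$ that are eigenvalues with finite-dimensional eigenspace. Suppose that $A_n$ converges to $A$ in the generalized strong resolvent sense, that is: (i) there is a constant $C$ with $\|J_n\|\le C$ for all $n$, and $\|J_n^*J_n\psi-\psi\|\to0$ for every $\psi\in\mathfrak H$; (ii) for one $z\in\Gamma$ we have $\|J_n^*R_{A_n}(z)J_n\psi-R_A(z)\psi\|\to0$ for every $\psi\in\mathfrak H$; in case this $z$ is real, it is required in addition that $\|R_{A_n}(z)J_n\psi-J_nR_A(z)\psi\|\to0$ for every $\psi\in\mathfrak H$. If $\lambda\in\sigma_{ess}(A)$,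 then for every $\varepsilon>0$ $$\lim_{n\to\infty}\dim\operatorname{ran}P_{A_n}\big((\lambda-\varepsilon,\lambda+\varepsilon)\big)=\infty ,$$ where the dimensions are taken in $\mathbb N\cup\{\infty\}$. -/

import Mathlib

open Filter Topology MeasureTheory
open scoped InnerProductSpace

noncomputable section

namespace UnboundedOp

variable {H : Type*} [NormedAddCommGroup H] [InnerProductSpace ℂ H]

/-- `R` is a bounded two-sided inverse of `A - z : D(A) → H`. -/
def IsResolventAt (A : H →ₗ.[ℂ] H) (z : ℂ) (R : H →L[ℂ] H) : Prop :=
  (∀ φ : H, ∃ h : R φ ∈ A.domain, A ⟨R φ, h⟩ - z • R φ = φ) ∧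
    ∀ ψ : A.domain, R (A ψ - z • (ψ : H)) = ψ

/-- The resolvent set `ρ(A)`. -/
def resolventSet (A : H →ₗ.[ℂ] H) : Set ℂ := {z | ∃ R : H →L[ℂ] H, IsResolventAt A z R}

/-- The spectrum `σ(A) = ℂ \ ρ(A)`. -/
def spectrum (A : H →ₗ.[ℂ] H) : Set ℂ := (resolventSet A)ᶜ

open Classical in
/-- The resolvent `R_A(z) = (A - z)⁻¹` for `z ∈ ρ(A)` (and `0` for other `z`). -/
def resolvent (A : H →ₗ.[ℂ] H) (z : ℂ) : H →L[ℂ] H :=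
  if h : ∃ R : H →L[ℂ] H, IsResolventAt A z R then h.choose else 0

/-- The eigenspace `{ψ ∈ D(A) | A ψ = z ψ}`, as a subspace of `H`. -/
def eigenspace (A : H →ₗ.[ℂ] H) (z : ℂ) : Submodule ℂ H :=
  A.graph.comap (LinearMap.prod LinearMap.id (z • LinearMap.id))

/-- The discrete spectrum: isolated points of the spectrum that are eigenvalues with a
finite-dimensional eigenspace. -/
def discreteSpectrum (A : H →ₗ.[ℂ] H) : Set ℂ :=
  {z | z ∈ spectrum A ∧ ¬ AccPt z (𝓟 (spectrum A)) ∧ eigenspace A z ≠ ⊥ ∧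
    FiniteDimensional ℂ (eigenspace A z)}

/-- The essential spectrum: the complement of the discrete spectrum in the spectrum. -/
def essentialSpectrum (A : H →ₗ.[ℂ] H) : Set ℂ := spectrum A \ discreteSpectrum A

variable [CompleteSpace H]

/-- A projection-valued measure on the Borel sets of `ℝ`: orthogonal projections in `H`, with value
the identity on `ℝ`, countably additive in the strong sense. -/
structure ProjectionValuedMeasure (H : Type*) [NormedAddCommGroup H] [InnerProductSpace ℂ H]
    [CompleteSpace H] where
  /-- The projection attached to a set (only the values on Borel sets matter). -/
  proj : Set ℝ → H →L[ℂ] H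
  isStarProjection : ∀ Ω, MeasurableSet Ω → IsStarProjection (proj Ω)
  proj_univ : proj Set.univ = 1
  hasSum : ∀ Ω : ℕ → Set ℝ, (∀ i, MeasurableSet (Ω i)) → Pairwise (Function.onFun Disjoint Ω) →
    ∀ ψ : H, HasSum (fun i => proj (Ω i) ψ) (proj (⋃ i, Ω i) ψ)

namespace ProjectionValuedMeasure

theorem proj_empty (E : ProjectionValuedMeasure H) (ψ : H) : E.proj ∅ ψ = 0 := by
  have h := (E.hasSum (fun _ => ∅) (fun _ => MeasurableSet.empty)
    (fun _ _ _ => by simp [Function.onFun]) ψ).summable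
  exact tendsto_nhds_unique tendsto_const_nhds h.tendsto_atTop_zero

theorem inner_nonneg (E : ProjectionValuedMeasure H) (ψ : H) {Ω : Set ℝ} (hΩ : MeasurableSet Ω) :
    0 ≤ (⟪ψ, E.proj Ω ψ⟫_ℂ).re := by
  have h := E.isStarProjection Ω hΩ
  have h2 : E.proj Ω (E.proj Ω ψ) = E.proj Ω ψ :=
    congrArg (fun T : H →L[ℂ] H => T ψ) h.isIdempotentElem
  have h3 : ContinuousLinearMap.adjoint (E.proj Ω) = E.proj Ω := h.isSelfAdjoint
  rw [← h2]
  nth_rewrite 1 [← h3]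
  rw [ContinuousLinearMap.adjoint_inner_right]
  exact inner_self_nonneg (𝕜 := ℂ)

/-- The spectral measure `μ_ψ(Ω) = ⟨ψ, E(Ω) ψ⟩` of a vector `ψ`. -/
def scalarMeasure (E : ProjectionValuedMeasure H) (ψ : H) : Measure ℝ :=
  Measure.ofMeasurable (fun Ω _ => ENNReal.ofReal (⟪ψ, E.proj Ω ψ⟫_ℂ).re)
    (by simp [E.proj_empty])
    (by
      intro Ω hΩ hd
      have h1 : HasSum (fun i => (⟪ψ, E.proj (Ω i) ψ⟫_ℂ).re)
          (⟪ψ, E.proj (⋃ i, Ω i) ψ⟫_ℂ).re :=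
        Complex.hasSum_re ((E.hasSum Ω hΩ hd ψ).mapL (innerSL ℂ ψ))
      rw [← h1.tsum_eq]
      exact ENNReal.ofReal_tsum_of_nonneg (fun i => E.inner_nonneg ψ (hΩ i)) h1.summable)

/-- `E` is the spectral measure of `A`, that is, `A = ∫ x dE(x)`: the domain of `A` is
`{ψ | ∫ x² dμ_ψ < ∞}`, and `⟨ψ, A ψ⟩ = ∫ x dμ_ψ`, `‖A ψ‖² = ∫ x² dμ_ψ` for `ψ` in it. -/
def Represents (E : ProjectionValuedMeasure H) (A : H →ₗ.[ℂ] H) : Prop :=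
  (∀ ψ : H, ψ ∈ A.domain ↔ Integrable (fun x : ℝ => x ^ 2) (E.scalarMeasure ψ)) ∧
    ∀ ψ : A.domain,
      ⟪(ψ : H), A ψ⟫_ℂ = ((∫ x, x ∂(E.scalarMeasure (ψ : H)) : ℝ) : ℂ) ∧
      ‖A ψ‖ ^ 2 = ∫ x, x ^ 2 ∂(E.scalarMeasure (ψ : H))

end ProjectionValuedMeasure

open Classical in
/-- The spectral projection `P_A(Ω)`, `Ω ⊆ ℝ` Borel, of a self-adjoint operator `A`: the value at
`Ω` of the (unique) projection-valued measure `E` with `A = ∫ x dE(x)`. -/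
def spectralProjection (A : H →ₗ.[ℂ] H) (Ω : Set ℝ) : H →L[ℂ] H :=
  if h : ∃ E : ProjectionValuedMeasure H, E.Represents A then h.choose.proj Ω else 0

/-- `dim ran T`, as an element of `ℕ ∪ {∞}`. -/
def dimRan (T : H →L[ℂ] H) : ℕ∞ :=
  Cardinal.toENat (Module.rank ℂ (LinearMap.range (T : H →ₗ[ℂ] H)))

/-- The set `Γ = ℂ \ Σ`, with `Σ` the closure of `σ(A) ∪ ⋃ₙ σ(Aₙ)`. -/
def commonResolventSet (A : H →ₗ.[ℂ] H) {K : ℕ → Type*} [∀ n, NormedAddCommGroup (K n)]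
    [∀ n, InnerProductSpace ℂ (K n)] (An : ∀ n, K n →ₗ.[ℂ] K n) : Set ℂ :=
  (closure (spectrum A ∪ ⋃ n, spectrum (An n)))ᶜ

/-- Generalized strong resolvent convergence of `An n` to `A` along the identification operators
`J n : H → K n`: `‖J n‖ ≤ C`, `J n† J n → 1` strongly, and `J n† R_{An n}(z) J n → R_A(z)` strongly
for one `z ∈ Γ`. If that `z` happens to be real, then moreover
`R_{An n}(z) J n - J n R_A(z) → 0` strongly (for non-real `z` and self-adjoint operators this is
automatic). -/
def GeneralizedStrongResolventConvergence (A : H →ₗ.[ℂ] H) {K : ℕ → Type*}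
    [∀ n, NormedAddCommGroup (K n)] [∀ n, InnerProductSpace ℂ (K n)] [∀ n, CompleteSpace (K n)]
    (An : ∀ n, K n →ₗ.[ℂ] K n) (J : ∀ n, H →L[ℂ] K n) : Prop :=
  (∃ C : ℝ, ∀ n, ‖J n‖ ≤ C) ∧
  (∀ ψ : H, Tendsto (fun n => ‖ContinuousLinearMap.adjoint (J n) (J n ψ) - ψ‖) atTop (𝓝 0)) ∧
  ∃ z ∈ commonResolventSet A An,
    (∀ ψ : H, Tendsto (fun n =>
      ‖ContinuousLinearMap.adjoint (J n) (resolvent (An n) z (J n ψ)) - resolvent A z ψ‖)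
      atTop (𝓝 0)) ∧
    (z.im = 0 → ∀ ψ : H, Tendsto (fun n =>
      ‖resolvent (An n) z (J n ψ) - J n (resolvent A z ψ)‖) atTop (𝓝 0))

end UnboundedOp

end

namespace UnboundedOp

/-! The spectral subspace of `A` for `(l - ε/2, l + ε/2)` is infinite-dimensional; otherwise `l`
would be a discrete point of the spectrum (`not_finiteDimensional_range_proj`). It therefore
contains subspaces `W` of every finite dimension, and `‖(A - l) w‖ ≤ ε/2 ‖w‖` on `W`.

Since `J n` need not map into the domain of `An n`, `W` is transported by `S n = Rn (J n) (A - z)`.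
The two forms of the hypothesis both give `Rn (J n) - (J n) R → 0` strongly, and `R (A - z) w = w`,
so `S n` is close to `J n` on `W`. There `J n` is almost isometric, and strong limits are uniform
because `W` is finite-dimensional. Hence `‖S n w‖` is nearly `‖w‖`, while `‖(An n - l) S n w‖` is at
most slightly more than `ε/2 ‖w‖`. A vector `v` killed by the spectral projection of `(l - ε, l +
ε)` satisfies `‖(An n - l) v‖ ≥ ε ‖v‖`, so this projection is injective on `S n W` for large `n`,
and its rank is at least `dim W` (`eventually_finrank_le_dimRan`).

Because `spectralProjection` is meaningful only if a spectral measure exists, the spectral theorem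
is needed (`exists_represents`). It comes from the continuous functional calculus of the normal
operator `(A - i)⁻¹`: Riesz–Markov gives scalar measures on its spectrum, which are pushed to `ℝ` by
`w ↦ Re (1/w)`. -/

theorem isResolventAt_resolvent {H : Type*} [NormedAddCommGroup H]
    [InnerProductSpace ℂ H] {A : H →ₗ.[ℂ] H} {z : ℂ} (hz : z ∈ resolventSet A) :
    IsResolventAt A z (resolvent A z) := by
  have hz' : ∃ R : H →L[ℂ] H, IsResolventAt A z R := hz
  rw [resolvent, dif_pos hz']
  exact hz'.choose_spec

/-! ### Resolvent set of a self-adjoint operator -/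

section SelfAdjoint

variable {H : Type*} [NormedAddCommGroup H] [InnerProductSpace ℂ H] [CompleteSpace H]
  {A : H →ₗ.[ℂ] H}

theorem inner_apply_left (hA : IsSelfAdjoint A) (x y : A.domain) :
    ⟪A x, (y : H)⟫_ℂ = ⟪(x : H), A y⟫_ℂ := by
  have h := LinearPMap.adjoint_isFormalAdjoint hA.dense_domain
  rw [LinearPMap.isSelfAdjoint_def.mp hA] at h
  exact h x y

theorem mem_domain_of_inner_eq (hA : IsSelfAdjoint A) {y w : H}
    (h : ∀ x : A.domain, ⟪w, (x : H)⟫_ℂ = ⟪y, A x⟫_ℂ) : ∃ hy : y ∈ A.domain, A ⟨y, hy⟩ = w := by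
  have key : ∃ hy : y ∈ (LinearPMap.adjoint A).domain, LinearPMap.adjoint A ⟨y, hy⟩ = w :=
    ⟨LinearPMap.mem_adjoint_domain_of_exists y ⟨w, h⟩,
      LinearPMap.adjoint_apply_eq hA.dense_domain _ h⟩
  rwa [LinearPMap.isSelfAdjoint_def.mp hA] at key

theorem inner_self_apply_im (hA : IsSelfAdjoint A) (x : A.domain) :
    (⟪(x : H), A x⟫_ℂ).im = 0 := by
  have h := inner_apply_left hA x x
  rw [← inner_conj_symm] at h
  exact Complex.conj_eq_iff_im.mp h

/-- A self-adjoint operator has `z` in its resolvent set as soon as `A - z` is bounded below and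
`A - z̄` is injective. -/
theorem mem_resolventSet_of_le_norm (hA : IsSelfAdjoint A) {z : ℂ} {c : ℝ} (hc : 0 < c)
    (h : ∀ ψ : A.domain, c * ‖(ψ : H)‖ ≤ ‖A ψ - z • (ψ : H)‖)
    (h' : ∀ ψ : A.domain, A ψ = (starRingEnd ℂ) z • (ψ : H) → (ψ : H) = 0) :
    z ∈ resolventSet A := by
  have hcl : IsClosed (A.graph : Set (H × H)) := hA.isClosed
  have : CompleteSpace A.graph := hcl.completeSpace_coe
  -- On the graph, which is complete because `A` is closed, `A - z` becomes a bounded operator;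
  -- being bounded below it is injective with closed range.
  let M : A.graph →L[ℂ] H :=
    ((ContinuousLinearMap.snd ℂ H H) - z • (ContinuousLinearMap.fst ℂ H H)) ∘L A.graph.subtypeL
  have hM : ∀ p : A.graph, M p = (p : H × H).2 - z • (p : H × H).1 := fun p => rfl
  have hgraph : ∀ p : A.graph, ∃ ψ : A.domain, (ψ : H) = (p : H × H).1 ∧ A ψ = (p : H × H).2 :=
    fun p => (LinearPMap.mem_graph_iff A).mp p.2
  have hbelow : ∀ p : A.graph, c * ‖(p : H × H).1‖ ≤ ‖M p‖ := by
    intro p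
    obtain ⟨ψ, h1, h2⟩ := hgraph p
    rw [hM, ← h1, ← h2]
    exact h ψ
  have hanti : AntilipschitzWith (Real.toNNReal (c⁻¹ + (1 + ‖z‖ * c⁻¹))) M := by
    refine AddMonoidHomClass.antilipschitz_of_bound M fun p => ?_
    rw [Real.coe_toNNReal _ (by positivity)]
    have h1 : ‖(p : H × H).1‖ ≤ c⁻¹ * ‖M p‖ := by
      rw [inv_mul_eq_div, le_div_iff₀ hc, mul_comm]
      exact hbelow p
    have h2 : ‖(p : H × H).2‖ ≤ ‖M p‖ + ‖z‖ * (c⁻¹ * ‖M p‖) := by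
      have : (p : H × H).2 = M p + z • (p : H × H).1 := by rw [hM]; abel
      rw [this]
      refine (norm_add_le _ _).trans ?_
      rw [norm_smul]
      gcongr
    have h3 : ‖p‖ = max ‖(p : H × H).1‖ ‖(p : H × H).2‖ := rfl
    have h4 : 0 ≤ c⁻¹ * ‖M p‖ := by positivity
    have h5 : 0 ≤ ‖M p‖ + ‖z‖ * (c⁻¹ * ‖M p‖) := by positivity
    rw [h3]
    refine max_le ?_ ?_ <;> nlinarith
  have hker : LinearMap.ker (M : A.graph →ₗ[ℂ] H) = ⊥ := LinearMap.ker_eq_bot.mpr hanti.injective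
  have hrangeclosed : IsClosed (Set.range M) := hanti.isClosed_range M.uniformContinuous
  have hrange : LinearMap.range (M : A.graph →ₗ[ℂ] H) = ⊤ := by
    have : CompleteSpace (LinearMap.range (M : A.graph →ₗ[ℂ] H)) := by
      apply IsClosed.completeSpace_coe (hs := _)
      exact hrangeclosed
    -- A vector orthogonal to the range lies in the domain of `A† = A` and is an eigenvector for
    -- `z̄`, unless it is zero.
    rw [← Submodule.orthogonal_eq_bot_iff, Submodule.eq_bot_iff]
    intro v hv
    rw [Submodule.mem_orthogonal] at hv
    have h1 : ∀ x : A.domain, ⟪(starRingEnd ℂ) z • v, (x : H)⟫_ℂ = ⟪v, A x⟫_ℂ := by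
      intro x
      have h2 := hv (M ⟨((x : H), A x), LinearPMap.mem_graph A x⟩) ⟨_, rfl⟩
      rw [hM, ← inner_conj_symm, map_eq_zero] at h2
      simp only [inner_sub_right, inner_smul_right, sub_eq_zero] at h2
      rw [inner_smul_left, Complex.conj_conj, h2]
    obtain ⟨hv1, hv2⟩ := mem_domain_of_inner_eq hA h1
    exact h' ⟨v, hv1⟩ hv2
  let e := ContinuousLinearEquiv.ofBijective M hker hrange
  refine ⟨(ContinuousLinearMap.fst ℂ H H) ∘L A.graph.subtypeL ∘L (e.symm : H →L[ℂ] A.graph),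
    fun φ => ?_, fun ψ => ?_⟩
  · obtain ⟨ψ, h1, h2⟩ := hgraph (e.symm φ)
    have h3 : M (e.symm φ) = φ := e.apply_symm_apply φ
    have h4 : ((e.symm φ : A.graph) : H × H).1 ∈ A.domain := h1 ▸ ψ.2
    have h5 : (⟨((e.symm φ : A.graph) : H × H).1, h4⟩ : A.domain) = ψ := Subtype.ext h1.symm
    refine ⟨h4, ?_⟩
    change A ⟨((e.symm φ : A.graph) : H × H).1, h4⟩ - z • ((e.symm φ : A.graph) : H × H).1 = φ
    rw [h5, h2, ← hM, h3]
  · have h1 : A ψ - z • (ψ : H) = e ⟨((ψ : H), A ψ), LinearPMap.mem_graph A ψ⟩ := rfl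
    rw [h1]
    change ((e.symm (e _) : A.graph) : H × H).1 = ψ
    rw [e.symm_apply_apply]

theorem mem_resolventSet_of_real (hA : IsSelfAdjoint A) {l c : ℝ} (hc : 0 < c)
    (h : ∀ ψ : A.domain, c * ‖(ψ : H)‖ ≤ ‖A ψ - (l : ℂ) • (ψ : H)‖) :
    (l : ℂ) ∈ resolventSet A := by
  refine mem_resolventSet_of_le_norm hA hc h fun ψ hψ => ?_
  have h1 := h ψ
  rw [Complex.conj_ofReal] at hψ
  rw [hψ, sub_self, norm_zero] at h1
  exact norm_le_zero_iff.mp (nonpos_of_mul_nonpos_right h1 hc)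

theorem inner_sub_smul_im (hA : IsSelfAdjoint A) (z : ℂ) (ψ : A.domain) :
    (⟪(ψ : H), A ψ - z • (ψ : H)⟫_ℂ).im = - (z.im * ‖(ψ : H)‖ ^ 2) := by
  rw [inner_sub_right, inner_smul_right, inner_self_eq_norm_sq_to_K, Complex.sub_im,
    inner_self_apply_im hA, zero_sub]
  rw [show ((RCLike.ofReal ‖(ψ : H)‖ : ℂ) ^ 2) = ((‖(ψ : H)‖ ^ 2 : ℝ) : ℂ) by push_cast; rfl,
    Complex.im_mul_ofReal]

/-- Since `⟪ψ, A ψ⟫` is real, Cauchy–Schwarz applied to `Im ⟪ψ, (A - w) ψ⟫` bounds `A - w` below by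
`|Im w|`. This serves for `w = z` and for `w = z̄`. -/
theorem mem_resolventSet_of_im_ne_zero (hA : IsSelfAdjoint A) {z : ℂ} (hz : z.im ≠ 0) :
    z ∈ resolventSet A := by
  have key : ∀ w : ℂ, ∀ ψ : A.domain, |w.im| * ‖(ψ : H)‖ ≤ ‖A ψ - w • (ψ : H)‖ := by
    intro w ψ
    by_cases h0 : ‖(ψ : H)‖ = 0
    · rw [h0, mul_zero]; positivity
    have h1 : |w.im| * ‖(ψ : H)‖ ^ 2 ≤ ‖(ψ : H)‖ * ‖A ψ - w • (ψ : H)‖ :=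
      calc |w.im| * ‖(ψ : H)‖ ^ 2 = |(⟪(ψ : H), A ψ - w • (ψ : H)⟫_ℂ).im| := by
            rw [inner_sub_smul_im hA, abs_neg, abs_mul, abs_sq]
        _ ≤ ‖⟪(ψ : H), A ψ - w • (ψ : H)⟫_ℂ‖ := Complex.abs_im_le_norm _
        _ ≤ _ := norm_inner_le_norm _ _
    have h2 : 0 < ‖(ψ : H)‖ := lt_of_le_of_ne (norm_nonneg _) (Ne.symm h0)
    refine le_of_mul_le_mul_left ?_ h2
    exact le_of_eq_of_le (by ring) h1
  refine mem_resolventSet_of_le_norm hA (abs_pos.mpr hz) (key z) fun ψ hψ => ?_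
  have h1 := key ((starRingEnd ℂ) z) ψ
  rw [hψ, sub_self, norm_zero, Complex.conj_im, abs_neg] at h1
  exact norm_le_zero_iff.mp (nonpos_of_mul_nonpos_right h1 (abs_pos.mpr hz))

theorem spectrum_subset_real (hA : IsSelfAdjoint A) {z : ℂ} (hz : z ∈ spectrum A) :
    ((z.re : ℝ) : ℂ) = z := by
  by_contra h
  exact hz (mem_resolventSet_of_im_ne_zero hA fun h0 => h (Complex.ext (by simp) (by simp [h0])))

end SelfAdjoint

/-! ### Projections attached to a family of scalar measures -/

section Projections

variable {H : Type*} [NormedAddCommGroup H] [InnerProductSpace ℂ H]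

/-- `P` is an orthogonal projection with `⟨ψ, P ψ⟩ = μ_ψ(Ω)` for all `ψ`. -/
def IsProjectionOf {X : Type*} [MeasurableSpace X] (μ : H → Measure X) (Ω : Set X)
    (P : H →L[ℂ] H) : Prop :=
  ∀ ψ, ⟪ψ, P ψ⟫_ℂ = ((μ ψ).real Ω : ℂ) ∧ ‖P ψ‖ ^ 2 = (μ ψ).real Ω

variable {X : Type*} [MeasurableSpace X] {μ : H → Measure X} {Ω Ω' : Set X} {P Q : H →L[ℂ] H}

theorem IsProjectionOf.unique (hP : IsProjectionOf μ Ω P) (hQ : IsProjectionOf μ Ω Q) : P = Q := by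
  apply ContinuousLinearMap.coe_injective
  rw [← ext_inner_map]
  intro x
  rw [← inner_conj_symm, ← inner_conj_symm (𝕜 := ℂ) ((Q : H →ₗ[ℂ] H) x)]
  exact congrArg _ ((hP x).1.trans (hQ x).1.symm)

theorem IsProjectionOf.isSymmetric (hP : IsProjectionOf μ Ω P) :
    (P : H →ₗ[ℂ] H).IsSymmetric := by
  rw [LinearMap.isSymmetric_iff_inner_map_self_real]
  intro v
  have h := (hP v).1
  rw [inner_conj_symm]
  change ⟪v, P v⟫_ℂ = ⟪P v, v⟫_ℂ
  rw [← inner_conj_symm (P v) v, h, Complex.conj_ofReal]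

theorem IsProjectionOf.apply_apply (hP : IsProjectionOf μ Ω P) (ψ : H) : P (P ψ) = P ψ := by
  have h : (P : H →ₗ[ℂ] H) ∘ₗ (P : H →ₗ[ℂ] H) = P := by
    rw [← ext_inner_map]
    intro x
    have h1 : ⟪P (P x), x⟫_ℂ = ⟪P x, P x⟫_ℂ := hP.isSymmetric (P x) x
    have h2 : ⟪P x, x⟫_ℂ = ⟪x, P x⟫_ℂ := hP.isSymmetric x x
    change ⟪P (P x), x⟫_ℂ = ⟪P x, x⟫_ℂ
    rw [h1, h2, (hP x).1, inner_self_eq_norm_sq_to_K, ← (hP x).2]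
    push_cast; rfl
  exact LinearMap.congr_fun h ψ

theorem IsProjectionOf.isStarProjection [CompleteSpace H] (hP : IsProjectionOf μ Ω P) :
    IsStarProjection P :=
  ⟨ContinuousLinearMap.ext hP.apply_apply,
    ContinuousLinearMap.isSelfAdjoint_iff_isSymmetric.mpr hP.isSymmetric⟩

theorem isProjectionOf_empty : IsProjectionOf μ ∅ (0 : H →L[ℂ] H) := fun ψ => by simp

theorem IsProjectionOf.compl [∀ ψ, IsFiniteMeasure (μ ψ)]
    (hμ : ∀ ψ, (μ ψ).real Set.univ = ‖ψ‖ ^ 2) (hΩ : MeasurableSet Ω)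
    (hP : IsProjectionOf μ Ω P) : IsProjectionOf μ Ωᶜ (1 - P) := by
  intro ψ
  rw [measureReal_compl hΩ, hμ]
  have h1 : (1 - P) ψ = ψ - P ψ := rfl
  refine ⟨?_, ?_⟩
  · rw [h1, inner_sub_right, (hP ψ).1, inner_self_eq_norm_sq_to_K]; push_cast; rfl
  · rw [h1, norm_sub_sq (𝕜 := ℂ), (hP ψ).1, (hP ψ).2]
    simp only [RCLike.re_to_complex, Complex.ofReal_re]
    ring

/-- The measure of `P ψ` has its whole mass `‖P ψ‖²` on `Ω`, so none is left for `Ω'`. -/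
theorem IsProjectionOf.apply_apply_of_disjoint [∀ ψ, IsFiniteMeasure (μ ψ)]
    (hμ : ∀ ψ, (μ ψ).real Set.univ = ‖ψ‖ ^ 2) (hΩ' : MeasurableSet Ω')
    (hd : Disjoint Ω Ω') (hP : IsProjectionOf μ Ω P) (hQ : IsProjectionOf μ Ω' Q) (ψ : H) :
    Q (P ψ) = 0 := by
  have h1 := (hP (P ψ)).2
  rw [hP.apply_apply] at h1
  have h2 := (hQ (P ψ)).2
  have h3 : (μ (P ψ)).real (Ω ∪ Ω') ≤ (μ (P ψ)).real Set.univ :=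
    measureReal_mono (Set.subset_univ _)
  rw [measureReal_union hd hΩ', hμ, ← h1, ← h2] at h3
  have h4 : ‖Q (P ψ)‖ ^ 2 ≤ 0 := by linarith
  exact norm_eq_zero.mp (pow_eq_zero_iff two_ne_zero |>.mp (le_antisymm h4 (sq_nonneg _)))

/-- The ranges are pairwise orthogonal and `∑ ‖P i ψ‖²` is the measure of the union, so the series
converges; Banach–Steinhaus makes its sum bounded. -/
theorem exists_isProjectionOf_iUnion [CompleteSpace H] [∀ ψ, IsFiniteMeasure (μ ψ)]
    (hμ : ∀ ψ, (μ ψ).real Set.univ = ‖ψ‖ ^ 2) {Ω : ℕ → Set X} {P : ℕ → H →L[ℂ] H}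
    (hΩ : ∀ i, MeasurableSet (Ω i)) (hd : Pairwise (Function.onFun Disjoint Ω))
    (hP : ∀ i, IsProjectionOf μ (Ω i) (P i)) :
    ∃ Q : H →L[ℂ] H, IsProjectionOf μ (⋃ i, Ω i) Q ∧ ∀ ψ, HasSum (fun i => P i ψ) (Q ψ) := by
  have hfam : OrthogonalFamily ℂ (fun i => LinearMap.range (P i : H →ₗ[ℂ] H))
      (fun i => (LinearMap.range (P i : H →ₗ[ℂ] H)).subtypeₗᵢ) := by
    rintro i j hij ⟨_, x, rfl⟩ ⟨_, y, rfl⟩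
    have h1 : ⟪P i x, P j y⟫_ℂ = ⟪x, P i (P j y)⟫_ℂ := (hP i).isSymmetric x (P j y)
    change ⟪P i x, P j y⟫_ℂ = 0
    rw [h1, (hP j).apply_apply_of_disjoint hμ (hΩ i) (hd hij.symm) (hP i), inner_zero_right]
  have hmeas : ∀ ψ, HasSum (fun i => (μ ψ).real (Ω i)) ((μ ψ).real (⋃ i, Ω i)) := by
    intro ψ
    have h1 := ENNReal.hasSum_toReal
      ((measure_iUnion (μ := μ ψ) hd hΩ).symm.trans_ne (measure_ne_top _ _))
    rwa [← ENNReal.tsum_toReal_eq fun i => measure_ne_top _ _, ← measure_iUnion hd hΩ] at h1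
  have hsum : ∀ ψ, Summable (fun i => P i ψ) := by
    intro ψ
    have h1 := hfam.summable_iff_norm_sq_summable (fun i => ⟨P i ψ, ψ, rfl⟩)
    refine h1.mpr ?_
    simpa only [Submodule.coe_norm, (hP _ ψ).2] using (hmeas ψ).summable
  let S : ℕ → H →L[ℂ] H := fun n => ∑ i ∈ Finset.range n, P i
  have hS : Tendsto (fun n ψ => S n ψ) atTop (𝓝 fun ψ => ∑' i, P i ψ) := by
    rw [tendsto_pi_nhds]
    intro ψ
    simpa [S, sum_apply] using (hsum ψ).hasSum.tendsto_sum_nat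
  let Q : H →L[ℂ] H := continuousLinearMapOfTendsto S hS
  have hQ : ∀ ψ, HasSum (fun i => P i ψ) (Q ψ) := fun ψ => (hsum ψ).hasSum
  refine ⟨Q, fun ψ => ⟨?_, ?_⟩, hQ⟩
  · have h1 : HasSum (fun i => ⟪ψ, P i ψ⟫_ℂ) ⟪ψ, Q ψ⟫_ℂ := (hQ ψ).mapL (innerSL ℂ ψ)
    simp only [(hP _ ψ).1] at h1
    exact h1.unique (Complex.hasSum_ofReal.mpr (hmeas ψ))
  · have h1 : Tendsto (fun n => ‖∑ i ∈ Finset.range n, P i ψ‖ ^ 2) atTop (𝓝 (‖Q ψ‖ ^ 2)) :=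
      ((hQ ψ).tendsto_sum_nat.norm).pow 2
    refine tendsto_nhds_unique h1 ?_
    refine (hmeas ψ).tendsto_sum_nat.congr fun n => ?_
    have h2 := hfam.norm_sum (fun i => ⟨P i ψ, ψ, rfl⟩) (Finset.range n)
    simp only [Submodule.coe_norm, Submodule.coe_subtypeₗᵢ, Submodule.subtype_apply, (hP _ ψ).2] at h2
    exact h2.symm

/-- By the π-λ theorem, complements and disjoint unions suffice; no product formula for
intersections is needed. -/
theorem exists_isProjectionOf [CompleteSpace H] [∀ ψ, IsFiniteMeasure (μ ψ)]
    (hμ : ∀ ψ, (μ ψ).real Set.univ = ‖ψ‖ ^ 2) {C : Set (Set X)}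
    (hC : ‹MeasurableSpace X› = MeasurableSpace.generateFrom C) (hpi : IsPiSystem C)
    (hCP : ∀ Ω ∈ C, ∃ P : H →L[ℂ] H, IsProjectionOf μ Ω P) (Ω : Set X) (hΩ : MeasurableSet Ω) :
    ∃ P : H →L[ℂ] H, IsProjectionOf μ Ω P := by
  induction Ω, hΩ using MeasurableSpace.induction_on_inter hC hpi with
  | empty => exact ⟨0, isProjectionOf_empty⟩
  | basic t ht => exact hCP t ht
  | compl t ht ih => obtain ⟨P, hP⟩ := ih; exact ⟨1 - P, hP.compl hμ ht⟩
  | iUnion f hd hm ih =>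
    choose P hP using ih
    obtain ⟨Q, hQ, -⟩ := exists_isProjectionOf_iUnion hμ hm hd hP
    exact ⟨Q, hQ⟩

theorem exists_projectionValuedMeasure [CompleteSpace H] (ν : H → Measure ℝ)
    [∀ ψ, IsFiniteMeasure (ν ψ)] (hν : ∀ ψ, (ν ψ).real Set.univ = ‖ψ‖ ^ 2)
    (hproj : ∀ Ω, MeasurableSet Ω → ∃ P : H →L[ℂ] H, IsProjectionOf ν Ω P) :
    ∃ E : ProjectionValuedMeasure H, ∀ ψ, E.scalarMeasure ψ = ν ψ := by
  have h : ∀ Ω : Set ℝ, ∃ P : H →L[ℂ] H, MeasurableSet Ω → IsProjectionOf ν Ω P := by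
    intro Ω
    by_cases hΩ : MeasurableSet Ω
    · obtain ⟨P, hP⟩ := hproj Ω hΩ; exact ⟨P, fun _ => hP⟩
    · exact ⟨0, fun h => absurd h hΩ⟩
  choose P hP using h
  refine ⟨⟨P, fun Ω hΩ => (hP Ω hΩ).isStarProjection, ?_, ?_⟩, fun ψ => ?_⟩
  · have h1 := (isProjectionOf_empty (μ := ν)).compl hν MeasurableSet.empty
    rw [Set.compl_empty, sub_zero] at h1
    exact (hP _ MeasurableSet.univ).unique h1
  · intro Ω hΩ hd ψ
    obtain ⟨Q, hQ, hs⟩ := exists_isProjectionOf_iUnion hν hΩ hd fun i => hP _ (hΩ i)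
    rw [(hP _ (MeasurableSet.iUnion hΩ)).unique hQ]
    exact hs ψ
  · ext Ω hΩ
    rw [ProjectionValuedMeasure.scalarMeasure, Measure.ofMeasurable_apply _ hΩ]
    change ENNReal.ofReal (⟪ψ, P Ω ψ⟫_ℂ).re = _
    rw [(hP Ω hΩ ψ).1, Complex.ofReal_re, ofReal_measureReal]

end Projections

/-! ### Scalar spectral measures of a continuous functional calculus -/

section FunctionalCalculus

theorem inner_map_star_mul {H : Type*} [NormedAddCommGroup H] [InnerProductSpace ℂ H]
    [CompleteSpace H] {X : Type*} [TopologicalSpace X] {Φ : C(X, ℂ) →⋆ₐ[ℂ] (H →L[ℂ] H)} (f g : C(X, ℂ)) (φ ψ : H) :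
    ⟪φ, Φ (star f * g) ψ⟫_ℂ = ⟪Φ f φ, Φ g ψ⟫_ℂ := by
  rw [map_mul, map_star, ContinuousLinearMap.star_eq_adjoint, mul_apply_eq_comp,
    ContinuousLinearMap.adjoint_inner_right]

variable {H : Type*} [NormedAddCommGroup H] [InnerProductSpace ℂ H] [CompleteSpace H]
  {X : Type*} [MetricSpace X] [CompactSpace X] [MeasurableSpace X] [BorelSpace X]
  {Φ : C(X, ℂ) →⋆ₐ[ℂ] (H →L[ℂ] H)} {ψ : H} {μ : Measure X}

/-- `μ` is the spectral measure of `ψ` for the functional calculus `Φ`. -/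
def IsSpectralMeasure (Φ : C(X, ℂ) →⋆ₐ[ℂ] (H →L[ℂ] H)) (ψ : H) (μ : Measure X) : Prop :=
  ∀ f : C(X, ℂ), ⟪ψ, Φ f ψ⟫_ℂ = ∫ x, f x ∂μ

/-- The functional `f ↦ ⟪ψ, Φ f ψ⟫` is positive, since `f = star g * g` with `g = √f` for `f ≥ 0`;
Riesz–Markov–Kakutani represents it by a measure. -/
theorem exists_isSpectralMeasure (Φ : C(X, ℂ) →⋆ₐ[ℂ] (H →L[ℂ] H)) (ψ : H) :
    ∃ μ : Measure X, IsFiniteMeasure μ ∧ IsSpectralMeasure Φ ψ μ := by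
  let o : C(X, ℝ) → C(X, ℂ) := fun f => ⟨fun x => (f x : ℂ), by fun_prop⟩
  have hreal : ∀ f : C(X, ℝ), (⟪ψ, Φ (o f) ψ⟫_ℂ).im = 0 := by
    intro f
    have h1 : o f = star (o f) * 1 := by ext x; simp [o]
    have h2 : ⟪ψ, Φ (o f) ψ⟫_ℂ = ⟪Φ (o f) ψ, ψ⟫_ℂ := by
      conv_lhs => rw [h1, inner_map_star_mul, map_one]
      rfl
    rw [← inner_conj_symm (Φ (o f) ψ)] at h2
    exact Complex.conj_eq_iff_im.mp h2.symm
  let Λ₀ : CompactlySupportedContinuousMap X ℝ →ₗ[ℝ] ℝ :=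
    { toFun := fun f => (⟪ψ, Φ (o f.toContinuousMap) ψ⟫_ℂ).re
      map_add' := fun f g => by
        have h1 : o (f + g).toContinuousMap = o f.toContinuousMap + o g.toContinuousMap := by
          ext x; simp [o]
        rw [h1, map_add, add_apply, inner_add_right, Complex.add_re]
      map_smul' := fun c f => by
        have h1 : o (c • f).toContinuousMap = (c : ℂ) • o f.toContinuousMap := by
          ext x; simp [o]
        rw [h1, map_smul, smul_apply, inner_smul_right, Complex.re_ofReal_mul]
        rfl }
  have hpos : ∀ f, 0 ≤ f → 0 ≤ Λ₀ f := by
    intro f hf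
    let g : C(X, ℂ) := ⟨fun x => ((Real.sqrt (f x) : ℝ) : ℂ), by fun_prop⟩
    have h1 : o f.toContinuousMap = star g * g := by
      ext x
      have : 0 ≤ f x := hf x
      simp only [o, g, ContinuousMap.coe_mk, ContinuousMap.mul_apply, ContinuousMap.star_apply,
        RCLike.star_def, Complex.conj_ofReal, ← Complex.ofReal_mul, Real.mul_self_sqrt this]
      rfl
    change 0 ≤ (⟪ψ, Φ (o f.toContinuousMap) ψ⟫_ℂ).re
    rw [h1, inner_map_star_mul]
    exact inner_self_nonneg (𝕜 := ℂ)
  let Λ := PositiveLinearMap.mk₀ Λ₀ hpos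
  refine ⟨RealRMK.rieszMeasure Λ, inferInstance, fun f => ?_⟩
  have hr : ∀ f : C(X, ℝ), ⟪ψ, Φ (o f) ψ⟫_ℂ = ((∫ x, f x ∂(RealRMK.rieszMeasure Λ) : ℝ) : ℂ) := by
    intro f
    have h1 := RealRMK.integral_rieszMeasure Λ (CompactlySupportedContinuousMap.continuousMapEquiv f)
    have h2 : Λ (CompactlySupportedContinuousMap.continuousMapEquiv f) = (⟪ψ, Φ (o f) ψ⟫_ℂ).re := rfl
    rw [h2] at h1
    refine Complex.ext ?_ ?_
    · rw [← h1, Complex.ofReal_re]; rfl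
    · rw [hreal, Complex.ofReal_im]
  let u : C(X, ℝ) := ⟨fun x => (f x).re, by fun_prop⟩
  let v : C(X, ℝ) := ⟨fun x => (f x).im, by fun_prop⟩
  have hf : f = o u + Complex.I • o v := by
    ext x
    simp only [o, u, v, ContinuousMap.coe_mk, ContinuousMap.add_apply, ContinuousMap.smul_apply,
      smul_eq_mul]
    rw [mul_comm, Complex.re_add_im]
  have hint : Integrable f (RealRMK.rieszMeasure Λ) :=
    f.continuous.integrable_of_hasCompactSupport (HasCompactSupport.of_compactSpace _)
  have h1 : ⟪ψ, Φ f ψ⟫_ℂ = ⟪ψ, Φ (o u) ψ⟫_ℂ + Complex.I * ⟪ψ, Φ (o v) ψ⟫_ℂ := by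
    conv_lhs => rw [hf, map_add, map_smul, add_apply, smul_apply, inner_add_right, inner_smul_right]
  rw [h1, hr, hr, ← integral_re_add_im hint, mul_comm]
  rfl

variable [IsFiniteMeasure μ]

theorem integrable_continuousMap {E : Type*} [NormedAddCommGroup E] (f : X → E)
    (hf : Continuous f) : Integrable f μ :=
  hf.integrable_of_hasCompactSupport (HasCompactSupport.of_compactSpace _)

theorem IsSpectralMeasure.norm_sq {X : Type*} [MetricSpace X] [MeasurableSpace X]
    {Φ : C(X, ℂ) →⋆ₐ[ℂ] (H →L[ℂ] H)} {μ : Measure X} (h : IsSpectralMeasure Φ ψ μ) (f : C(X, ℂ)) :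
    ‖Φ f ψ‖ ^ 2 = ∫ x, ‖f x‖ ^ 2 ∂μ := by
  have h1 := h (star f * f)
  rw [inner_map_star_mul, inner_self_eq_norm_sq_to_K] at h1
  have h2 : ∀ x, (star f * f) x = ((‖f x‖ ^ 2 : ℝ) : ℂ) := by
    intro x
    simp only [ContinuousMap.mul_apply, ContinuousMap.star_apply, RCLike.star_def]
    rw [Complex.conj_mul']; push_cast; rfl
  simp only [h2] at h1
  exact Complex.ofReal_injective
    ((Complex.ofReal_pow _ _).trans (h1.trans (integral_ofReal (𝕜 := ℂ))))

theorem IsSpectralMeasure.measureReal_univ {X : Type*} [MetricSpace X] [MeasurableSpace X]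
    {Φ : C(X, ℂ) →⋆ₐ[ℂ] (H →L[ℂ] H)} {μ : Measure X} (h : IsSpectralMeasure Φ ψ μ) :
    μ.real Set.univ = ‖ψ‖ ^ 2 := by
  have h1 := h.norm_sq 1
  rw [map_one] at h1
  simpa using h1.symm

/-- As `f ↦ Φ f ψ` is isometric for the `L²(μ)` norm, dominated convergence makes the sequence
Cauchy. This stands in for a Borel functional calculus. -/
theorem IsSpectralMeasure.exists_tendsto (h : IsSpectralMeasure Φ ψ μ) {g : ℕ → C(X, ℂ)}
    {l : X → ℂ} {G : X → ℝ} (hG : Integrable (fun x => G x ^ 2) μ)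
    (hgG : ∀ n, ∀ᵐ x ∂μ, ‖g n x‖ ≤ G x)
    (hl : ∀ᵐ x ∂μ, Tendsto (fun n => g n x) atTop (𝓝 (l x))) :
    ∃ v, Tendsto (fun n => Φ (g n) ψ) atTop (𝓝 v) := by
  refine cauchySeq_tendsto_of_complete (cauchySeq_iff_tendsto_dist_atTop_0.mpr ?_)
  have h1 : ∀ p : ℕ × ℕ, dist (Φ (g p.1) ψ) (Φ (g p.2) ψ) =
      Real.sqrt (∫ x, ‖g p.1 x - g p.2 x‖ ^ 2 ∂μ) := by
    intro p
    have h2 := h.norm_sq (g p.1 - g p.2)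
    rw [map_sub, sub_apply] at h2
    rw [dist_eq_norm]
    simp only [ContinuousMap.sub_apply] at h2
    rw [← h2, Real.sqrt_sq (norm_nonneg _)]
  simp only [h1]
  rw [← Real.sqrt_zero]
  refine (Real.continuous_sqrt.tendsto 0).comp ?_
  have h3 : (0 : ℝ) = ∫ x, (0 : ℝ) ∂μ := by simp
  rw [h3]
  refine tendsto_integral_filter_of_dominated_convergence (fun x => 4 * G x ^ 2) ?_ ?_
    (hG.const_mul 4) ?_
  · exact Eventually.of_forall fun p =>
      (integrable_continuousMap (μ := μ) _ (by fun_prop)).aestronglyMeasurable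
  · refine Eventually.of_forall fun p => ?_
    filter_upwards [hgG p.1, hgG p.2] with x hx hy
    rw [Real.norm_of_nonneg (by positivity)]
    have h4 : ‖g p.1 x - g p.2 x‖ ≤ 2 * G x := (norm_sub_le _ _).trans (by linarith)
    calc ‖g p.1 x - g p.2 x‖ ^ 2 ≤ (2 * G x) ^ 2 := by gcongr
      _ = 4 * G x ^ 2 := by ring
  · filter_upwards [hl] with x hx
    have h5 : Tendsto (fun p : ℕ × ℕ => g p.1 x - g p.2 x) atTop (𝓝 (l x - l x)) := by
      rw [← prod_atTop_atTop_eq]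
      exact (hx.comp tendsto_fst).sub (hx.comp tendsto_snd)
    rw [sub_self] at h5
    simpa using h5.norm.pow 2

/-- The projection is the strong limit of `Φ` on thickened indicators, which tend to the indicator
of `F` because `F` is closed. -/
theorem exists_isProjectionOf_isClosed {μ : H → Measure X} [∀ ψ, IsFiniteMeasure (μ ψ)]
    (h : ∀ ψ, IsSpectralMeasure Φ ψ (μ ψ)) {F : Set X} (hF : IsClosed F) :
    ∃ P : H →L[ℂ] H, IsProjectionOf μ F P := by
  let δ : ℕ → ℝ := fun n => 1 / ((n : ℝ) + 1)
  have hδ : ∀ n, 0 < δ n := fun n => Nat.one_div_pos_of_nat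
  have hδ0 : Tendsto δ atTop (𝓝 0) := tendsto_one_div_add_atTop_nhds_zero_nat
  let t : ℕ → X → ℝ := fun n x => (thickenedIndicator (hδ n) F x : ℝ)
  have ht : ∀ n, Continuous (t n) := fun n =>
    NNReal.continuous_coe.comp (thickenedIndicator (hδ n) F).continuous
  have ht0 : ∀ n x, 0 ≤ t n x := fun n x => NNReal.coe_nonneg _
  have ht1 : ∀ n x, t n x ≤ 1 := fun n x => by
    exact_mod_cast thickenedIndicator_le_one (hδ n) F x
  have htlim : ∀ x, Tendsto (fun n => t n x) atTop (𝓝 (F.indicator (fun _ => (1 : ℝ)) x)) := by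
    intro x
    have h1 := thickenedIndicator_tendsto_indicator_closure hδ hδ0 F
    rw [hF.closure_eq, tendsto_pi_nhds] at h1
    have h2 := (NNReal.continuous_coe.tendsto _).comp (h1 x)
    have h3 : ((F.indicator (fun _ => (1 : NNReal)) x : NNReal) : ℝ) =
        F.indicator (fun _ => (1 : ℝ)) x := by by_cases hx : x ∈ F <;> simp [hx]
    rw [← h3]
    exact h2
  let g : ℕ → C(X, ℂ) := fun n => ⟨fun x => (t n x : ℂ), Complex.continuous_ofReal.comp (ht n)⟩
  have hv : ∀ ψ, ∃ v, Tendsto (fun n => Φ (g n) ψ) atTop (𝓝 v) := by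
    intro ψ
    refine (h ψ).exists_tendsto (G := fun _ => 1)
      (l := fun x => ((F.indicator (fun _ => (1 : ℝ)) x : ℝ) : ℂ)) (integrable_const _) ?_ ?_
    · refine fun n => ae_of_all _ fun x => ?_
      change ‖(t n x : ℂ)‖ ≤ 1
      rw [Complex.norm_real, Real.norm_of_nonneg (ht0 n x)]
      exact ht1 n x
    · exact ae_of_all _ fun x => (Complex.continuous_ofReal.tendsto _).comp (htlim x)
  choose p hp using hv
  have hint : ∀ ψ (k : ℕ), k ≠ 0 → Tendsto (fun n => ∫ x, t n x ^ k ∂(μ ψ)) atTop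
      (𝓝 ((μ ψ).real F)) := by
    intro ψ k hk
    have h2 : (μ ψ).real F = ∫ x, F.indicator (fun _ => (1 : ℝ)) x ^ k ∂(μ ψ) := by
      have : ∀ x, F.indicator (fun _ => (1 : ℝ)) x ^ k = F.indicator (fun _ => (1 : ℝ)) x := by
        intro x
        by_cases hx : x ∈ F <;> simp [hx, hk]
      simp only [this]
      rw [integral_indicator hF.measurableSet]
      simp
    rw [h2]
    refine tendsto_integral_of_dominated_convergence (fun _ => 1)
      (fun n => (integrable_continuousMap (μ := μ ψ) _ ((ht n).pow k)).aestronglyMeasurable)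
      (integrable_const _) (fun n => ae_of_all _ fun x => ?_)
      (ae_of_all _ fun x => (htlim x).pow k)
    rw [Real.norm_of_nonneg (pow_nonneg (ht0 n x) k)]
    exact pow_le_one₀ (ht0 n x) (ht1 n x)
  let P : H →L[ℂ] H := continuousLinearMapOfTendsto (fun n => Φ (g n)) (tendsto_pi_nhds.mpr hp)
  refine ⟨P, fun ψ => ⟨?_, ?_⟩⟩
  · have h1 : Tendsto (fun n => ⟪ψ, Φ (g n) ψ⟫_ℂ) atTop (𝓝 ⟪ψ, P ψ⟫_ℂ) :=
      tendsto_const_nhds.inner (hp ψ)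
    refine tendsto_nhds_unique h1 ?_
    have h2 := (Complex.continuous_ofReal.tendsto _).comp (hint ψ 1 one_ne_zero)
    refine h2.congr fun n => ?_
    rw [h ψ (g n)]
    simp only [pow_one, Function.comp_apply]
    exact integral_ofReal.symm
  · have h1 : Tendsto (fun n => ‖Φ (g n) ψ‖ ^ 2) atTop (𝓝 (‖P ψ‖ ^ 2)) := (hp ψ).norm.pow 2
    refine tendsto_nhds_unique h1 ?_
    refine (hint ψ 2 two_ne_zero).congr fun n => ?_
    rw [(h ψ).norm_sq (g n)]
    refine integral_congr_ae (ae_of_all _ fun x => ?_)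
    change t n x ^ 2 = ‖(t n x : ℂ)‖ ^ 2
    rw [Complex.norm_real, Real.norm_eq_abs, sq_abs]

end FunctionalCalculus

/-! ### Normality of the resolvent at `i` -/

section ResolventIdentities

variable {H : Type*} [NormedAddCommGroup H] [InnerProductSpace ℂ H] [CompleteSpace H]
  {A : H →ₗ.[ℂ] H} {z : ℂ} {R S : H →L[ℂ] H}

theorem IsResolventAt.inner_im (hA : IsSelfAdjoint A) (hR : IsResolventAt A z R) (χ : H) :
    (⟪χ, R χ⟫_ℂ).im = z.im * ‖R χ‖ ^ 2 := by
  obtain ⟨h, h1⟩ := hR.1 χ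
  have h2 := inner_sub_smul_im hA z ⟨R χ, h⟩
  rw [h1] at h2
  rw [← inner_conj_symm, Complex.conj_im, h2, neg_neg]

theorem IsResolventAt.adjoint_eq (hA : IsSelfAdjoint A) (hR : IsResolventAt A z R)
    (hS : IsResolventAt A ((starRingEnd ℂ) z) S) : ContinuousLinearMap.adjoint R = S := by
  symm
  rw [ContinuousLinearMap.eq_adjoint_iff]
  intro x y
  obtain ⟨hx, hx1⟩ := hS.1 x
  obtain ⟨hy, hy1⟩ := hR.1 y
  have h1 := inner_apply_left hA ⟨S x, hx⟩ ⟨R y, hy⟩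
  conv_lhs => rw [← hy1]
  conv_rhs => rw [← hx1]
  rw [inner_sub_left, inner_sub_right, h1, inner_smul_left, inner_smul_right, Complex.conj_conj]

theorem IsResolventAt.injective {H : Type*} [NormedAddCommGroup H]
    [InnerProductSpace ℂ H] {A : H →ₗ.[ℂ] H} {z : ℂ} {R : H →L[ℂ] H} (hR : IsResolventAt A z R) : Function.Injective R := by
  intro x y hxy
  obtain ⟨hx, hx1⟩ := hR.1 x
  obtain ⟨hy, hy1⟩ := hR.1 y
  rw [← hx1, ← hy1]
  simp only [hxy]

/-- The adjoint of `R` is the resolvent at `-i`, and `‖R v‖²` and `‖R† v‖²` both equal `Im ⟪v, R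
v⟫`. -/
theorem exists_resolvent_I (hA : IsSelfAdjoint A) :
    ∃ R : H →L[ℂ] H, IsResolventAt A Complex.I R ∧ IsStarNormal R := by
  obtain ⟨R, hR⟩ := mem_resolventSet_of_im_ne_zero hA (z := Complex.I) (by simp)
  obtain ⟨S, hS⟩ := mem_resolventSet_of_im_ne_zero hA (z := (starRingEnd ℂ) Complex.I) (by simp)
  refine ⟨R, hR, ContinuousLinearMap.isStarNormal_iff_norm_eq_adjoint.mpr fun v => ?_⟩
  have h1 := hR.inner_im hA v
  have h2 := hS.inner_im hA v
  have h3 := hR.adjoint_eq hA hS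
  rw [← h3, ContinuousLinearMap.adjoint_inner_right, ← inner_conj_symm, Complex.conj_im, h1] at h2
  simp only [Complex.I_im, Complex.conj_I, Complex.neg_im, one_mul, neg_one_mul, neg_inj] at h2
  exact (sq_eq_sq₀ (norm_nonneg _) (norm_nonneg _)).mp h2

end ResolventIdentities

/-! ### The spectral theorem -/

section SpectralTheorem

variable {H : Type*} [NormedAddCommGroup H] [InnerProductSpace ℂ H] [CompleteSpace H]
  {X : Type*} [MetricSpace X] [CompactSpace X] [MeasurableSpace X] [BorelSpace X]
  {Φ : C(X, ℂ) →⋆ₐ[ℂ] (H →L[ℂ] H)} {μ : H → Measure X} [∀ ψ, IsFiniteMeasure (μ ψ)]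

/-- Both measures integrate a continuous `g` to `⟪χ, Φ (|f|² g) χ⟫`. -/
theorem IsSpectralMeasure.map_eq_withDensity (h : ∀ ψ, IsSpectralMeasure Φ ψ (μ ψ))
    (f : C(X, ℂ)) (χ : H) :
    μ (Φ f χ) = (μ χ).withDensity (fun x => ((‖f x‖₊ ^ 2 : NNReal) : ENNReal)) := by
  have hmeas : Measurable fun x => ‖f x‖₊ ^ 2 := by fun_prop
  have hint : Integrable (fun x => ((‖f x‖₊ ^ 2 : NNReal) : ℝ)) (μ χ) :=
    integrable_continuousMap _ (by fun_prop)
  have : IsFiniteMeasure ((μ χ).withDensity fun x => ((‖f x‖₊ ^ 2 : NNReal) : ENNReal)) := by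
    refine isFiniteMeasure_withDensity ?_
    have := hint.2
    rw [hasFiniteIntegral_iff_enorm] at this
    simpa [enorm_eq_nnnorm] using this.ne
  refine ext_of_forall_integral_eq_of_IsFiniteMeasure fun g => ?_
  rw [integral_withDensity_eq_integral_smul hmeas]
  let G : C(X, ℂ) := ⟨fun x => (g x : ℂ), by fun_prop⟩
  have h1 := h (Φ f χ) G
  have h2 : ⟪Φ f χ, Φ G (Φ f χ)⟫_ℂ = ⟪χ, Φ (star f * (G * f)) χ⟫_ℂ := by
    rw [inner_map_star_mul, map_mul, mul_apply_eq_comp]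
  rw [h2, h χ] at h1
  have h3 : ∀ x, (star f * (G * f)) x = ((‖f x‖₊ ^ 2 • g x : ℝ) : ℂ) := by
    intro x
    simp only [ContinuousMap.mul_apply, ContinuousMap.star_apply, RCLike.star_def, G,
      ContinuousMap.coe_mk]
    rw [mul_left_comm, Complex.conj_mul', mul_comm, NNReal.smul_def, smul_eq_mul]
    push_cast
    rfl
  simp only [h3] at h1
  exact (Complex.ofReal_injective ((integral_ofReal (𝕜 := ℂ)).symm.trans
    (h1.trans (integral_ofReal (𝕜 := ℂ))))).symm

/-- `Φ f` annihilates the range of the projection of the zero set of `f`, so injectivity forces that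
projection to vanish. -/
theorem measure_zeros_eq_zero (h : ∀ ψ, IsSpectralMeasure Φ ψ (μ ψ)) (f : C(X, ℂ))
    (hf : Function.Injective (Φ f)) (ψ : H) : ∀ᵐ x ∂(μ ψ), f x ≠ 0 := by
  have hcl : IsClosed {x | f x = 0} := isClosed_eq f.continuous continuous_const
  obtain ⟨P, hP⟩ := exists_isProjectionOf_isClosed h hcl
  have h1 : (μ (P ψ)).real {x | f x = 0}ᶜ = 0 := by
    rw [measureReal_compl hcl.measurableSet, (h _).measureReal_univ, ← (hP (P ψ)).2,
      hP.apply_apply, sub_self]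
  have h2 : ∀ᵐ x ∂(μ (P ψ)), f x = 0 := by
    rw [ae_iff]
    exact (measureReal_eq_zero_iff).mp h1
  have h3 : Φ f (P ψ) = 0 := by
    have h4 := (h (P ψ)).norm_sq f
    rw [integral_eq_zero_of_ae (h2.mono fun x hx => by simp [hx])] at h4
    simpa using h4
  have h5 : P ψ = 0 := hf (h3.trans (map_zero _).symm)
  have h6 := (hP ψ).2
  rw [h5, norm_zero, zero_pow two_ne_zero] at h6
  rw [ae_iff]
  simpa using (measureReal_eq_zero_iff).mp h6.symm

/-- `ψ` is in the range of `Φ f`, if `f⁻¹` is square integrable for its spectral measure. -/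
theorem exists_map_eq_of_integrable (h : ∀ ψ, IsSpectralMeasure Φ ψ (μ ψ)) (f : C(X, ℂ))
    (hf : Function.Injective (Φ f)) {ψ : H}
    (hint : Integrable (fun x => (‖f x‖⁻¹) ^ 2) (μ ψ)) : ∃ χ, Φ f χ = ψ := by
  let δ : ℕ → ℝ := fun n => 1 / ((n : ℝ) + 1)
  have hδ : ∀ n, 0 < δ n := fun n => Nat.one_div_pos_of_nat
  have hδ0 : Tendsto δ atTop (𝓝 0) := tendsto_one_div_add_atTop_nhds_zero_nat
  have hden : ∀ n x, ((‖f x‖ ^ 2 + δ n : ℝ) : ℂ) ≠ 0 := fun n x => by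
    have := hδ n
    exact_mod_cast (by positivity : (‖f x‖ ^ 2 + δ n : ℝ) ≠ 0)
  -- A continuous regularization of `1/f`: it is dominated by `1/|f|`, and `f * g n → 1` boundedly
  -- off the null set of zeros.
  let g : ℕ → C(X, ℂ) := fun n =>
    ⟨fun x => star (f x) / ((‖f x‖ ^ 2 + δ n : ℝ) : ℂ),
      Continuous.div (by fun_prop) (by fun_prop) (hden n)⟩
  have hne := measure_zeros_eq_zero h f hf ψ
  have hden_lim : ∀ x, Tendsto (fun n => ((‖f x‖ ^ 2 + δ n : ℝ) : ℂ)) atTop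
      (𝓝 ((‖f x‖ ^ 2 : ℝ) : ℂ)) := by
    intro x
    have h1 : Tendsto (fun n => ‖f x‖ ^ 2 + δ n) atTop (𝓝 (‖f x‖ ^ 2 + 0)) :=
      tendsto_const_nhds.add hδ0
    rw [add_zero] at h1
    exact (Complex.continuous_ofReal.tendsto _).comp h1
  have hg : ∀ n x, f x * g n x = ((‖f x‖ ^ 2 / (‖f x‖ ^ 2 + δ n) : ℝ) : ℂ) := by
    intro n x
    change f x * (star (f x) / _) = _
    rw [← mul_div_assoc, RCLike.star_def, Complex.mul_conj', Complex.ofReal_div, Complex.ofReal_pow]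
  have hg1 : ∀ n x, ‖f x‖ ^ 2 / (‖f x‖ ^ 2 + δ n) ≤ 1 := fun n x => by
    have := hδ n
    rw [div_le_one (by positivity)]
    linarith
  have hg0 : ∀ n x, 0 ≤ ‖f x‖ ^ 2 / (‖f x‖ ^ 2 + δ n) := fun n x => by
    have := hδ n
    positivity
  obtain ⟨χ, hχ⟩ : ∃ χ, Tendsto (fun n => Φ (g n) ψ) atTop (𝓝 χ) := by
    refine (h ψ).exists_tendsto (G := fun x => ‖f x‖⁻¹)
      (l := fun x => star (f x) / ((‖f x‖ ^ 2 : ℝ) : ℂ)) hint (fun n => ?_) ?_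
    · filter_upwards [hne] with x hx
      have hx' : 0 < ‖f x‖ := norm_pos_iff.mpr hx
      rw [← one_div, le_div_iff₀ hx', mul_comm, ← norm_mul, hg, Complex.norm_real,
        Real.norm_of_nonneg (hg0 n x)]
      exact hg1 n x
    · filter_upwards [hne] with x hx
      have hx' : 0 < ‖f x‖ := norm_pos_iff.mpr hx
      exact tendsto_const_nhds.div (hden_lim x) (by exact_mod_cast (by positivity : ‖f x‖ ^ 2 ≠ 0))
  refine ⟨χ, tendsto_nhds_unique (((Φ f).continuous.tendsto χ).comp hχ) ?_⟩
  rw [tendsto_iff_norm_sub_tendsto_zero]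
  have h1 : ∀ n, ‖((Φ f) ∘ fun n => Φ (g n) ψ) n - ψ‖ =
      Real.sqrt (∫ x, (‖f x‖ ^ 2 / (‖f x‖ ^ 2 + δ n) - 1) ^ 2 ∂(μ ψ)) := by
    intro n
    have h2 := (h ψ).norm_sq (f * g n - 1)
    rw [map_sub, map_mul, map_one, sub_apply, mul_apply_eq_comp] at h2
    have h3 : ∀ x, ‖(f * g n - 1) x‖ ^ 2 = (‖f x‖ ^ 2 / (‖f x‖ ^ 2 + δ n) - 1) ^ 2 := by
      intro x
      rw [ContinuousMap.sub_apply, ContinuousMap.mul_apply, hg, ContinuousMap.one_apply,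
        ← Complex.ofReal_one, ← Complex.ofReal_sub, Complex.norm_real, Real.norm_eq_abs, sq_abs]
    simp only [h3] at h2
    rw [← h2, Real.sqrt_sq (norm_nonneg _)]
    rfl
  simp only [h1]
  rw [← Real.sqrt_zero]
  refine (Real.continuous_sqrt.tendsto 0).comp ?_
  have h3 : (0 : ℝ) = ∫ x, (0 : ℝ) ∂(μ ψ) := by simp
  rw [h3]
  refine tendsto_integral_of_dominated_convergence (fun _ => 1) (fun n => ?_)
    (integrable_const _) (fun n => ae_of_all _ fun x => ?_) ?_
  · refine (integrable_continuousMap (μ := μ ψ) _ ?_).aestronglyMeasurable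
    refine ((Continuous.div (by fun_prop) (by fun_prop) fun x => ?_).sub continuous_const).pow 2
    have := hδ n
    positivity
  · rw [Real.norm_of_nonneg (sq_nonneg _)]
    have := hg1 n x
    have := hg0 n x
    nlinarith
  · filter_upwards [hne] with x hx
    have hx' : 0 < ‖f x‖ := norm_pos_iff.mpr hx
    have h4 : Tendsto (fun n => ‖f x‖ ^ 2 + δ n) atTop (𝓝 (‖f x‖ ^ 2 + 0)) :=
      tendsto_const_nhds.add hδ0
    rw [add_zero] at h4
    have h5 : Tendsto (fun n => (‖f x‖ ^ 2 / (‖f x‖ ^ 2 + δ n) - 1) ^ 2) atTop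
        (𝓝 ((‖f x‖ ^ 2 / (‖f x‖ ^ 2) - 1) ^ 2)) :=
      (((tendsto_const_nhds.div h4 (by positivity)).sub tendsto_const_nhds).pow 2)
    rwa [div_self (by positivity), sub_self, zero_pow two_ne_zero] at h5

end SpectralTheorem

/-- The spectral theorem: every self-adjoint operator has a spectral measure. -/
theorem exists_represents {H : Type*} [NormedAddCommGroup H] [InnerProductSpace ℂ H]
    [CompleteSpace H] {A : H →ₗ.[ℂ] H} (hA : IsSelfAdjoint A) :
    ∃ E : ProjectionValuedMeasure H, E.Represents A := by
  obtain ⟨R, hR, hn⟩ := exists_resolvent_I hA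
  let X := _root_.spectrum ℂ R
  let Φ : C(X, ℂ) →⋆ₐ[ℂ] (H →L[ℂ] H) := cfcHom (R := ℂ) (a := R) hn
  let ι : C(X, ℂ) := ⟨fun w => (w : ℂ), by fun_prop⟩
  have hι : Φ ι = R := cfcHom_id (R := ℂ) (a := R) hn
  have : CompactSpace X := isCompact_iff_compactSpace.mp (spectrum.isCompact R)
  choose μ hfin hμ using exists_isSpectralMeasure Φ
  have hinj : Function.Injective (Φ ι) := by rw [hι]; exact hR.injective
  -- The identity `R - R† = 2i R† R` puts the spectrum on the circle `Im w = |w|²`, whose nonzero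
  -- points are `w = 1/(x - i)` with `x` real.
  have him : ∀ w : X, (w : ℂ).im = ‖(w : ℂ)‖ ^ 2 := by
    have h1 : ι - star ι = (2 * Complex.I) • (star ι * ι) := by
      apply cfcHom_injective (R := ℂ) (a := R) hn
      change Φ _ = Φ _
      apply ContinuousLinearMap.coe_injective
      rw [← ext_inner_map]
      intro χ
      rw [← inner_conj_symm, ← inner_conj_symm (𝕜 := ℂ) ((Φ ((2 * Complex.I) • (star ι * ι)) :
        H →ₗ[ℂ] H) χ)]
      refine congrArg _ ?_
      change ⟪χ, Φ (ι - star ι) χ⟫_ℂ = ⟪χ, Φ ((2 * Complex.I) • (star ι * ι)) χ⟫_ℂ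
      rw [map_sub, map_smul, sub_apply, smul_apply, inner_sub_right,
        inner_smul_right, inner_map_star_mul, ← mul_one (star ι), inner_map_star_mul, map_one, hι,
        one_apply_eq_self, inner_self_eq_norm_sq_to_K, ← inner_conj_symm (R χ) χ]
      have h2 := hR.inner_im hA χ
      rw [Complex.I_im, one_mul] at h2
      rw [Complex.sub_conj, h2]
      push_cast
      simp only [Complex.coe_algebraMap]
      ring
    intro w
    have h2 := congrArg (fun f : C(X, ℂ) => f w) h1
    simp only [ContinuousMap.sub_apply, ContinuousMap.star_apply, ContinuousMap.smul_apply,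
      ContinuousMap.mul_apply, RCLike.star_def, smul_eq_mul] at h2
    change (w : ℂ) - (starRingEnd ℂ) (w : ℂ) =
      2 * Complex.I * ((starRingEnd ℂ) (w : ℂ) * (w : ℂ)) at h2
    rw [Complex.sub_conj, Complex.conj_mul'] at h2
    have h3 := congrArg Complex.im h2
    simp only [Complex.mul_im, Complex.mul_re, Complex.ofReal_re, Complex.ofReal_im, Complex.I_re,
      Complex.I_im, Complex.re_ofNat, Complex.im_ofNat, ← Complex.ofReal_pow] at h3
    linarith
  have hne : ∀ ψ, ∀ᵐ w : X ∂(μ ψ), (w : ℂ) ≠ 0 := measure_zeros_eq_zero hμ ι hinj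
  -- This recovers `x` from `w = 1/(x - i)`. At `w = 0` it takes the value `0`, which is harmless:
  -- that point is null for every `μ ψ`.
  let h : X → ℝ := fun w => ((w : ℂ)⁻¹).re
  have hh : Measurable h := by fun_prop
  have hh0 : ∀ w : X, ‖(w : ℂ)‖ ^ 2 * h w = (w : ℂ).re := by
    intro w
    by_cases hw : (w : ℂ) = 0
    · simp [hw]
    · have h1 : ‖(w : ℂ)‖ ≠ 0 := norm_ne_zero_iff.mpr hw
      simp only [h, Complex.inv_re, Complex.normSq_eq_norm_sq]
      field_simp
  have hh1 : ∀ w : X, (w : ℂ) ≠ 0 → ‖(w : ℂ)‖ ^ 2 * h w ^ 2 = 1 - ‖(w : ℂ)‖ ^ 2 := by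
    intro w hw
    have h1 : ‖(w : ℂ)‖ ≠ 0 := norm_ne_zero_iff.mpr hw
    have h2 : ‖(w : ℂ)‖ ^ 2 = (w : ℂ).re ^ 2 + (w : ℂ).im ^ 2 := by
      rw [← Complex.normSq_eq_norm_sq, Complex.normSq_apply]; ring
    have h3 : ‖(w : ℂ)‖ ^ 2 * (‖(w : ℂ)‖ ^ 2 * h w ^ 2) =
        ‖(w : ℂ)‖ ^ 2 * (1 - ‖(w : ℂ)‖ ^ 2) := by
      have h4 : ‖(w : ℂ)‖ ^ 2 * (‖(w : ℂ)‖ ^ 2 * h w ^ 2) = (w : ℂ).re ^ 2 := by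
        rw [← hh0]; ring
      rw [h4]
      have h5 : (w : ℂ).im ^ 2 = (‖(w : ℂ)‖ ^ 2) ^ 2 := by rw [him]
      linarith
    exact mul_left_cancel₀ (pow_ne_zero 2 h1) h3
  have hh2 : ∀ w : X, (w : ℂ) ≠ 0 → (‖(w : ℂ)‖⁻¹) ^ 2 = h w ^ 2 + 1 := by
    intro w hw
    have h1 : ‖(w : ℂ)‖ ≠ 0 := norm_ne_zero_iff.mpr hw
    have h2 := hh1 w hw
    field_simp
    linarith
  have hdom : ∀ ψ, ψ ∈ A.domain ↔ ∃ χ, R χ = ψ := fun ψ =>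
    ⟨fun hψ => ⟨_, hR.2 ⟨ψ, hψ⟩⟩, fun ⟨χ, hχ⟩ => hχ ▸ (hR.1 χ).1⟩
  let ν : H → Measure ℝ := fun ψ => (μ ψ).map h
  obtain ⟨E, hE⟩ := exists_projectionValuedMeasure ν
    (fun ψ => by rw [map_measureReal_apply hh MeasurableSet.univ, Set.preimage_univ,
      (hμ ψ).measureReal_univ])
    (fun Ω hΩ => by
      obtain ⟨P, hP⟩ := exists_isProjectionOf (μ := μ) (fun ψ => (hμ ψ).measureReal_univ)
        ((BorelSpace.measurable_eq (α := X)).trans borel_eq_generateFrom_isClosed)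
        isPiSystem_isClosed (fun F hF => exists_isProjectionOf_isClosed hμ hF) (h ⁻¹' Ω) (hh hΩ)
      refine ⟨P, fun ψ => ?_⟩
      rw [map_measureReal_apply hh hΩ]
      exact hP ψ)
  have hdens : ∀ χ, μ (R χ) =
      (μ χ).withDensity (fun w : X => ((‖(w : ℂ)‖₊ ^ 2 : NNReal) : ENNReal)) := by
    intro χ
    have := IsSpectralMeasure.map_eq_withDensity hμ ι χ
    rwa [hι] at this
  have hdm : Measurable fun w : X => ‖(w : ℂ)‖₊ ^ 2 := by fun_prop
  have hsq : Continuous fun x : ℝ => x ^ 2 := by fun_prop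
  refine ⟨E, fun ψ => ?_, fun ψ => ?_⟩
  -- The domain of `A` is the range of `R`. For `ψ = R χ` the density `|w|²` gives `x² |w|² ≤ 1`;
  -- conversely `1/|w|² = x² + 1` is integrable, so `ψ` is in the range.
  · rw [hE, integrable_map_measure hsq.aestronglyMeasurable hh.aemeasurable, hdom]
    constructor
    · rintro ⟨χ, rfl⟩
      rw [hdens, integrable_withDensity_iff_integrable_smul hdm]
      refine Integrable.of_bound (C := 1) (by fun_prop) ?_
      filter_upwards [hne χ] with w hw
      have h1 := hh1 w hw
      change ‖‖(w : ℂ)‖ ^ 2 * h w ^ 2‖ ≤ 1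
      rw [Real.norm_of_nonneg (by positivity), h1]
      have := sq_nonneg ‖(w : ℂ)‖
      linarith
    · intro hint
      rw [← hι]
      refine exists_map_eq_of_integrable hμ ι hinj ?_
      refine (hint.add (integrable_const (1 : ℝ))).congr ?_
      filter_upwards [hne ψ] with w hw
      exact (hh2 w hw).symm
  · obtain ⟨χ, hχ⟩ := (hdom ψ).mp ψ.2
    -- In the functional calculus `A ψ` becomes `1 + i w`, which is `x w`.
    have hAψ : A ψ = χ + Complex.I • R χ := by
      obtain ⟨h1, h2⟩ := hR.1 χ
      have h3 : (⟨R χ, h1⟩ : A.domain) = ψ := Subtype.ext hχ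
      rw [h3] at h2
      exact sub_eq_iff_eq_add.mp h2
    rw [hE, integral_map hh.aemeasurable (by fun_prop), integral_map hh.aemeasurable (by fun_prop),
      ← hχ, hdens, integral_withDensity_eq_integral_smul hdm,
      integral_withDensity_eq_integral_smul hdm, hAψ]
    constructor
    · have h1 : ⟪R χ, χ + Complex.I • R χ⟫_ℂ = ⟪χ, Φ (star ι * (1 + Complex.I • ι)) χ⟫_ℂ := by
        rw [inner_map_star_mul, hι, map_add, map_one, map_smul, hι]
        rfl
      rw [h1, hμ χ]
      refine Eq.trans ?_ (integral_ofReal (𝕜 := ℂ))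
      refine integral_congr_ae (ae_of_all _ fun w => ?_)
      change (starRingEnd ℂ) (w : ℂ) * (1 + Complex.I * (w : ℂ)) =
        ((‖(w : ℂ)‖ ^ 2 * h w : ℝ) : ℂ)
      rw [hh0, mul_add, mul_left_comm, Complex.conj_mul', ← Complex.ofReal_pow, ← him]
      apply Complex.ext <;> simp
    · have h1 : χ + Complex.I • R χ = Φ (1 + Complex.I • ι) χ := by
        rw [map_add, map_one, map_smul, hι]
        rfl
      rw [h1, (hμ χ).norm_sq]
      refine integral_congr_ae ?_
      filter_upwards [hne χ] with w hw
      change ‖1 + Complex.I * (w : ℂ)‖ ^ 2 = ‖(w : ℂ)‖ ^ 2 * h w ^ 2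
      rw [hh1 w hw, ← Complex.normSq_eq_norm_sq, ← Complex.normSq_eq_norm_sq]
      have h2 := him w
      rw [← Complex.normSq_eq_norm_sq] at h2
      have h3 : Complex.normSq (1 + Complex.I * (w : ℂ)) =
          1 - 2 * (w : ℂ).im + Complex.normSq (w : ℂ) := by
        simp [Complex.normSq_apply]; ring
      rw [h3, h2]
      ring

/-- Uniqueness of the measure is not needed, since the estimates below hold for every representing
measure. -/
theorem exists_spectralProjection_eq {H : Type*} [NormedAddCommGroup H] [InnerProductSpace ℂ H]
    [CompleteSpace H] {A : H →ₗ.[ℂ] H} (hA : IsSelfAdjoint A) :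
    ∃ E : ProjectionValuedMeasure H, E.Represents A ∧ spectralProjection A = E.proj := by
  have h := exists_represents hA
  refine ⟨h.choose, h.choose_spec, funext fun Ω => ?_⟩
  rw [spectralProjection, dif_pos h]

/-! ### Estimates for `A - l` on spectral subspaces -/

namespace ProjectionValuedMeasure

variable {H : Type*} [NormedAddCommGroup H] [InnerProductSpace ℂ H] [CompleteSpace H]
  {A : H →ₗ.[ℂ] H} {E : ProjectionValuedMeasure H}

theorem norm_proj_sq (E : ProjectionValuedMeasure H) (ψ : H) {Ω : Set ℝ} (hΩ : MeasurableSet Ω) :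
    ⟪ψ, E.proj Ω ψ⟫_ℂ = ((‖E.proj Ω ψ‖ ^ 2 : ℝ) : ℂ) := by
  have h := E.isStarProjection Ω hΩ
  have h2 : E.proj Ω (E.proj Ω ψ) = E.proj Ω ψ :=
    congrArg (fun T : H →L[ℂ] H => T ψ) h.isIdempotentElem
  have h3 : ContinuousLinearMap.adjoint (E.proj Ω) = E.proj Ω := h.isSelfAdjoint
  conv_lhs => rw [← h2, ← h3, ContinuousLinearMap.adjoint_inner_right, h3,
    inner_self_eq_norm_sq_to_K]
  push_cast; rfl

theorem scalarMeasure_apply (E : ProjectionValuedMeasure H) (ψ : H) {Ω : Set ℝ}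
    (hΩ : MeasurableSet Ω) : E.scalarMeasure ψ Ω = ENNReal.ofReal (‖E.proj Ω ψ‖ ^ 2) := by
  rw [scalarMeasure, Measure.ofMeasurable_apply _ hΩ, E.norm_proj_sq ψ hΩ, Complex.ofReal_re]

theorem scalarMeasure_univ (E : ProjectionValuedMeasure H) (ψ : H) :
    E.scalarMeasure ψ Set.univ = ENNReal.ofReal (‖ψ‖ ^ 2) := by
  rw [E.scalarMeasure_apply ψ MeasurableSet.univ, E.proj_univ]; rfl

instance isFiniteMeasure_scalarMeasure (E : ProjectionValuedMeasure H) (ψ : H) :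
    IsFiniteMeasure (E.scalarMeasure ψ) :=
  ⟨by rw [E.scalarMeasure_univ]; exact ENNReal.ofReal_lt_top⟩

theorem scalarMeasure_real_univ (E : ProjectionValuedMeasure H) (ψ : H) :
    (E.scalarMeasure ψ).real Set.univ = ‖ψ‖ ^ 2 := by
  rw [measureReal_def, E.scalarMeasure_univ, ENNReal.toReal_ofReal (sq_nonneg _)]

theorem isProjectionOf (E : ProjectionValuedMeasure H) {Ω : Set ℝ} (hΩ : MeasurableSet Ω) :
    IsProjectionOf E.scalarMeasure Ω (E.proj Ω) := by
  intro ψ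
  have h : (E.scalarMeasure ψ).real Ω = ‖E.proj Ω ψ‖ ^ 2 := by
    rw [measureReal_def, E.scalarMeasure_apply ψ hΩ, ENNReal.toReal_ofReal (sq_nonneg _)]
  rw [h]
  exact ⟨E.norm_proj_sq ψ hΩ, rfl⟩

theorem ae_notMem_iff (E : ProjectionValuedMeasure H) {Ω : Set ℝ} (hΩ : MeasurableSet Ω) (ψ : H) :
    (∀ᵐ x ∂(E.scalarMeasure ψ), x ∉ Ω) ↔ E.proj Ω ψ = 0 := by
  rw [ae_iff]
  simp only [not_not]
  change E.scalarMeasure ψ Ω = 0 ↔ _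
  rw [← measureReal_eq_zero_iff, ← (E.isProjectionOf hΩ ψ).2]
  simp

theorem ae_mem_iff (E : ProjectionValuedMeasure H) {Ω : Set ℝ} (hΩ : MeasurableSet Ω) (ψ : H) :
    (∀ᵐ x ∂(E.scalarMeasure ψ), x ∈ Ω) ↔ E.proj Ω ψ = ψ := by
  have h1 := ((E.isProjectionOf hΩ).compl E.scalarMeasure_real_univ hΩ).unique
    (E.isProjectionOf hΩ.compl)
  have h2 := E.ae_notMem_iff hΩ.compl ψ
  simp only [Set.mem_compl_iff, not_not] at h2
  rw [h2, ← h1, sub_apply, one_apply_eq_self, sub_eq_zero, eq_comm]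

/-- Expanding the square uses only the mass and the first two moments of the scalar measure. -/
theorem Represents.integrable_sub_sq (hE : E.Represents A) (ψ : A.domain) (l : ℝ) :
    Integrable (fun x : ℝ => (x - l) ^ 2) (E.scalarMeasure (ψ : H)) ∧
      ‖A ψ - (l : ℂ) • (ψ : H)‖ ^ 2 = ∫ x, (x - l) ^ 2 ∂(E.scalarMeasure (ψ : H)) := by
  have h2 : Integrable (fun x : ℝ => x ^ 2) (E.scalarMeasure (ψ : H)) := (hE.1 _).mp ψ.2
  have h1 : Integrable (fun x : ℝ => x) (E.scalarMeasure (ψ : H)) := by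
    refine (h2.add (integrable_const (1 : ℝ))).mono' (by fun_prop) (ae_of_all _ fun x => ?_)
    change ‖x‖ ≤ x ^ 2 + 1
    rw [Real.norm_eq_abs, abs_le]
    constructor <;> nlinarith [sq_nonneg (x - 1), sq_nonneg (x + 1)]
  have h3 : Integrable (fun x : ℝ => x ^ 2 - 2 * l * x) (E.scalarMeasure (ψ : H)) :=
    h2.sub (h1.const_mul (2 * l))
  have h0 : Integrable (fun _ : ℝ => l ^ 2) (E.scalarMeasure (ψ : H)) := integrable_const _
  have heq : (fun x : ℝ => (x - l) ^ 2) = fun x => (x ^ 2 - 2 * l * x) + l ^ 2 := by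
    funext x; ring
  rw [heq]
  refine ⟨h3.add h0, ?_⟩
  rw [integral_add h3 h0, integral_sub h2 (h1.const_mul _), integral_const_mul, ← (hE.2 ψ).2,
    integral_const, E.scalarMeasure_real_univ, norm_sub_sq (𝕜 := ℂ), inner_smul_right,
    ← inner_conj_symm, (hE.2 ψ).1, Complex.conj_ofReal, norm_smul, Complex.norm_real,
    ← Complex.ofReal_mul, RCLike.re_to_complex, Complex.ofReal_re, mul_pow, Real.norm_eq_abs,
    sq_abs, smul_eq_mul]
  ring

theorem Represents.mem_domain_of_proj_eq (hE : E.Represents A) {l δ : ℝ} {ψ : H}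
    (hψ : E.proj (Set.Ioo (l - δ) (l + δ)) ψ = ψ) : ψ ∈ A.domain := by
  rw [hE.1]
  have hae := (E.ae_mem_iff measurableSet_Ioo ψ).mpr hψ
  refine Integrable.of_bound (C := (|l| + δ) ^ 2) (by fun_prop) ?_
  filter_upwards [hae] with x hx
  rw [Real.norm_of_nonneg (sq_nonneg _), ← sq_abs x]
  have h1 : |x| ≤ |l| + δ := by
    have h2 : |x - l| ≤ δ := abs_le.mpr ⟨by linarith [hx.1], by linarith [hx.2]⟩
    have h3 := abs_add_le l (x - l)
    rw [add_sub_cancel] at h3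
    linarith
  gcongr

theorem Represents.norm_sub_le_of_proj_eq (hE : E.Represents A) {l δ : ℝ} (hδ : 0 ≤ δ)
    (ψ : A.domain) (hψ : E.proj (Set.Ioo (l - δ) (l + δ)) (ψ : H) = ψ) :
    ‖A ψ - (l : ℂ) • (ψ : H)‖ ≤ δ * ‖(ψ : H)‖ := by
  have hae := (E.ae_mem_iff measurableSet_Ioo (ψ : H)).mpr hψ
  obtain ⟨h1, h2⟩ := hE.integrable_sub_sq ψ l
  refine (sq_le_sq₀ (norm_nonneg _) (by positivity)).mp ?_
  rw [h2, mul_pow, ← E.scalarMeasure_real_univ, mul_comm, ← smul_eq_mul, ← integral_const]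
  refine integral_mono_ae h1 (integrable_const _) ?_
  filter_upwards [hae] with x hx
  exact sq_le_sq' (by linarith [hx.1]) (by linarith [hx.2])

/-- If `m` has distance at least `d` to the complement of `Ω`, then `‖(A - m) ψ‖` is at least `d`
times the norm of the component of `ψ` orthogonal to the spectral subspace of `Ω`. -/
theorem Represents.mul_norm_sub_proj_le (hE : E.Represents A) {m d : ℝ} (hd : 0 ≤ d) {Ω : Set ℝ}
    (hΩ : MeasurableSet Ω) (hm : ∀ x ∉ Ω, d ≤ |x - m|) (ψ : A.domain) :
    d * ‖(ψ : H) - E.proj Ω ψ‖ ≤ ‖A ψ - (m : ℂ) • (ψ : H)‖ := by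
  obtain ⟨h1, h2⟩ := hE.integrable_sub_sq ψ m
  refine (sq_le_sq₀ (by positivity) (norm_nonneg _)).mp ?_
  have h3 := (((E.isProjectionOf hΩ).compl E.scalarMeasure_real_univ hΩ) (ψ : H)).2
  rw [sub_apply, one_apply_eq_self] at h3
  rw [h2, mul_pow, h3, mul_comm, ← smul_eq_mul, ← integral_indicator_const _ hΩ.compl]
  refine integral_mono ((integrable_const _).indicator hΩ.compl) h1 fun x => ?_
  by_cases hx : x ∈ Ω
  · simpa [hx] using sq_nonneg (x - m)
  · have h4 := hm x hx
    simp only [Set.mem_compl_iff, hx, not_false_eq_true, Set.indicator_of_mem]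
    rw [← sq_abs (x - m)]
    gcongr

theorem Represents.proj_eq_of_apply_eq (hE : E.Represents A) {m : ℝ} {Ω : Set ℝ}
    (hΩ : MeasurableSet Ω) (hm : m ∈ Ω) (ψ : A.domain) (hψ : A ψ = (m : ℂ) • (ψ : H)) :
    E.proj Ω ψ = ψ := by
  obtain ⟨h1, h2⟩ := hE.integrable_sub_sq ψ m
  rw [hψ, sub_self, norm_zero, zero_pow two_ne_zero, eq_comm,
    integral_eq_zero_iff_of_nonneg (fun x => sq_nonneg _) h1] at h2
  rw [← E.ae_mem_iff hΩ]
  filter_upwards [h2] with x hx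
  have h3 : x - m = 0 := pow_eq_zero_iff two_ne_zero |>.mp hx
  rwa [sub_eq_zero.mp h3]

end ProjectionValuedMeasure

/-! ### Essential spectrum and infinite-dimensional spectral subspaces -/

variable {H : Type*} [NormedAddCommGroup H] [InnerProductSpace ℂ H] [CompleteSpace H]
  {A : H →ₗ.[ℂ] H} {E : ProjectionValuedMeasure H}

theorem mem_eigenspace_iff {H : Type*} [NormedAddCommGroup H] [InnerProductSpace ℂ H]
    {A : H →ₗ.[ℂ] H} {z : ℂ} {ψ : H} :
    ψ ∈ eigenspace A z ↔ ∃ h : ψ ∈ A.domain, A ⟨ψ, h⟩ = z • ψ := by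
  change (ψ, z • ψ) ∈ A.graph ↔ _
  rw [LinearPMap.mem_graph_iff]
  constructor
  · rintro ⟨y, h1, h2⟩
    have h1' : (y : H) = ψ := h1
    subst h1'
    exact ⟨y.2, h2⟩
  · rintro ⟨h, h1⟩
    exact ⟨⟨ψ, h⟩, rfl, h1⟩

/-- Points of the spectrum in an open set with finite-dimensional spectral subspace are
eigenvalues. -/
theorem eigenspace_ne_bot_of_finiteDimensional (hA : IsSelfAdjoint A) (hE : E.Represents A)
    {Ω : Set ℝ} (hΩ : IsOpen Ω)
    [hfin : FiniteDimensional ℂ (LinearMap.range (E.proj Ω : H →ₗ[ℂ] H))]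
    {m : ℝ} (hm : m ∈ Ω) (hspec : (m : ℂ) ∈ spectrum A) : eigenspace A m ≠ ⊥ := by
  obtain ⟨d, hd, hball⟩ := Metric.isOpen_iff.mp hΩ m hm
  have hdist : ∀ x ∉ Ω, d ≤ |x - m| := fun x hx => by
    by_contra h
    exact hx (hball (by rw [Metric.mem_ball, Real.dist_eq]; exact not_le.mp h))
  -- Since `m` is in the spectrum, `A - m` is not bounded below: there are approximate unit
  -- eigenvectors. Their components off `Ω` tend to zero, those in `Ω` lie in a compact ball, and
  -- closedness of `A` makes a limit point an eigenvector.
  have happrox : ∀ n : ℕ, ∃ ψ : A.domain, ‖(ψ : H)‖ = 1 ∧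
      ‖A ψ - (m : ℂ) • (ψ : H)‖ ≤ 1 / ((n : ℝ) + 1) := by
    intro n
    by_contra! h
    refine hspec (mem_resolventSet_of_real hA (c := 1 / ((n : ℝ) + 1)) Nat.one_div_pos_of_nat
      fun ψ => ?_)
    by_cases h0 : ‖(ψ : H)‖ = 0
    · rw [h0, mul_zero]; positivity
    have h1 := h ((‖(ψ : H)‖⁻¹ : ℂ) • ψ) (by
      rw [Submodule.coe_smul, norm_smul, norm_inv, Complex.norm_real, norm_norm,
        inv_mul_cancel₀ h0])
    rw [LinearPMap.map_smul, Submodule.coe_smul, smul_comm, ← smul_sub, norm_smul, norm_inv,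
      Complex.norm_real, norm_norm, inv_mul_eq_div, lt_div_iff₀ (by positivity)] at h1
    exact h1.le
  choose ψ hψ1 hψ2 using happrox
  have hlim0 : Tendsto (fun n => A (ψ n) - (m : ℂ) • (ψ n : H)) atTop (𝓝 0) :=
    squeeze_zero_norm hψ2 tendsto_one_div_add_atTop_nhds_zero_nat
  have hproj0 : Tendsto (fun n => (ψ n : H) - E.proj Ω (ψ n)) atTop (𝓝 0) := by
    have h1 : Tendsto (fun n => d⁻¹ * ‖A (ψ n) - (m : ℂ) • (ψ n : H)‖) atTop (𝓝 (d⁻¹ * 0)) :=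
      (tendsto_zero_iff_norm_tendsto_zero.mp hlim0).const_mul _
    rw [mul_zero] at h1
    refine squeeze_zero_norm (fun n => ?_) h1
    rw [inv_mul_eq_div, le_div_iff₀ hd, mul_comm]
    exact hE.mul_norm_sub_proj_le hd.le hΩ.measurableSet hdist (ψ n)
  let V := LinearMap.range (E.proj Ω : H →ₗ[ℂ] H)
  have : ProperSpace V := FiniteDimensional.proper ℂ V
  let v : ℕ → V := fun n => ⟨E.proj Ω (ψ n), _, rfl⟩
  have hv : ∀ n, v n ∈ Metric.closedBall (0 : V) 1 := by
    intro n
    rw [mem_closedBall_zero_iff]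
    have h1 := (E.isStarProjection Ω hΩ.measurableSet).norm_le
    calc ‖E.proj Ω (ψ n)‖ ≤ ‖E.proj Ω‖ * ‖(ψ n : H)‖ := (E.proj Ω).le_opNorm _
      _ ≤ 1 := by rw [hψ1, mul_one]; exact h1
  obtain ⟨φ, -, s, hs, hφ⟩ := (isCompact_closedBall (0 : V) 1).tendsto_subseq hv
  have hφ' : Tendsto (fun n => E.proj Ω (ψ (s n))) atTop (𝓝 (φ : H)) :=
    (continuous_subtype_val.tendsto φ).comp hφ
  have hψφ : Tendsto (fun n => (ψ (s n) : H)) atTop (𝓝 (φ : H)) := by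
    have h1 := (hproj0.comp hs.tendsto_atTop).add hφ'
    simpa using h1
  have hAφ : Tendsto (fun n => A (ψ (s n))) atTop (𝓝 ((m : ℂ) • (φ : H))) := by
    have h1 := (hlim0.comp hs.tendsto_atTop).add (hψφ.const_smul (m : ℂ))
    simpa using h1
  have hgraph : ((φ : H), (m : ℂ) • (φ : H)) ∈ A.graph := by
    have hcl : IsClosed (A.graph : Set (H × H)) := hA.isClosed
    exact hcl.mem_of_tendsto (hψφ.prodMk_nhds hAφ)
      (Eventually.of_forall fun n => LinearPMap.mem_graph A (ψ (s n)))
  have hφ1 : ‖(φ : H)‖ = 1 := by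
    refine tendsto_nhds_unique hψφ.norm ?_
    simp only [hψ1]
    exact tendsto_const_nhds
  intro hbot
  have h1 : (φ : H) ∈ eigenspace A m := hgraph
  rw [hbot, Submodule.mem_bot] at h1
  rw [h1, norm_zero] at hφ1
  exact zero_ne_one hφ1

theorem eigenspace_le_range_proj (hE : E.Represents A) {Ω : Set ℝ} (hΩ : MeasurableSet Ω) {m : ℝ}
    (hm : m ∈ Ω) : eigenspace A m ≤ LinearMap.range (E.proj Ω : H →ₗ[ℂ] H) := by
  intro ψ hψ
  obtain ⟨h, h1⟩ := mem_eigenspace_iff.mp hψ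
  exact ⟨ψ, hE.proj_eq_of_apply_eq hΩ hm ⟨ψ, h⟩ h1⟩

theorem inner_eq_zero_of_mem_eigenspace (hA : IsSelfAdjoint A) {l m : ℝ} (hlm : l ≠ m) {φ ψ : H}
    (hφ : φ ∈ eigenspace A l) (hψ : ψ ∈ eigenspace A m) : ⟪φ, ψ⟫_ℂ = 0 := by
  obtain ⟨h1, h2⟩ := mem_eigenspace_iff.mp hφ
  obtain ⟨h3, h4⟩ := mem_eigenspace_iff.mp hψ
  have h5 := inner_apply_left hA ⟨φ, h1⟩ ⟨ψ, h3⟩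
  rw [h2, h4, inner_smul_left, inner_smul_right, Complex.conj_ofReal, ← sub_eq_zero, ← sub_mul,
    mul_eq_zero, ← Complex.ofReal_sub, Complex.ofReal_eq_zero, sub_eq_zero] at h5
  exact h5.resolve_left hlm

/-- The spectral subspaces of neighbourhoods of a point of the essential spectrum are
infinite-dimensional. -/
theorem not_finiteDimensional_range_proj (hA : IsSelfAdjoint A) (hE : E.Represents A) {l : ℝ}
    (hl : (l : ℂ) ∈ essentialSpectrum A) {δ : ℝ} (hδ : 0 < δ) :
    ¬ FiniteDimensional ℂ (LinearMap.range
      (E.proj (Set.Ioo (l - δ) (l + δ)) : H →ₗ[ℂ] H)) := by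
  intro hfin
  have hmem : l ∈ Set.Ioo (l - δ) (l + δ) := ⟨by linarith, by linarith⟩
  refine hl.2 ⟨hl.1, fun hacc => ?_, eigenspace_ne_bot_of_finiteDimensional hA hE isOpen_Ioo
    hmem hl.1, Submodule.finiteDimensional_of_le
      (eigenspace_le_range_proj hE measurableSet_Ioo hmem)⟩
  -- If `l` were not isolated, infinitely many spectral points near `l` would all be eigenvalues,
  -- with orthogonal eigenvectors in one finite-dimensional space.
  have hacc' : AccPt (l : ℂ) (𝓟 (Metric.ball (l : ℂ) δ ∩ spectrum A)) :=
    hacc.nhds_inter (Metric.ball_mem_nhds _ hδ)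
  have hinf := Set.Infinite.of_accPt hacc'
  have : Infinite ↑(Metric.ball (l : ℂ) δ ∩ spectrum A) := hinf.to_subtype
  have hre : ∀ w : ↑(Metric.ball (l : ℂ) δ ∩ spectrum A), (((w : ℂ).re : ℝ) : ℂ) = w :=
    fun w => spectrum_subset_real hA w.2.2
  have hIoo : ∀ w : ↑(Metric.ball (l : ℂ) δ ∩ spectrum A),
      (w : ℂ).re ∈ Set.Ioo (l - δ) (l + δ) := by
    intro w
    have h1 := w.2.1
    rw [Metric.mem_ball, ← hre w, Complex.dist_eq, ← Complex.ofReal_sub, Complex.norm_real,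
      Real.norm_eq_abs, abs_lt] at h1
    exact ⟨by linarith [h1.1], by linarith [h1.2]⟩
  have hev : ∀ w : ↑(Metric.ball (l : ℂ) δ ∩ spectrum A),
      ∃ φ ∈ eigenspace A ((w : ℂ).re : ℂ), φ ≠ 0 := fun w =>
    Submodule.exists_mem_ne_zero_of_ne_bot (eigenspace_ne_bot_of_finiteDimensional hA hE
      isOpen_Ioo (hIoo w) ((hre w).symm ▸ w.2.2))
  choose φ hφ hφ0 using hev
  let v : ↑(Metric.ball (l : ℂ) δ ∩ spectrum A) →
      LinearMap.range (E.proj (Set.Ioo (l - δ) (l + δ)) : H →ₗ[ℂ] H) := fun w =>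
    ⟨φ w, eigenspace_le_range_proj hE measurableSet_Ioo (hIoo w) (hφ w)⟩
  have hv : LinearIndependent ℂ v := by
    refine linearIndependent_of_ne_zero_of_inner_eq_zero (fun w h => hφ0 w (congrArg Subtype.val h))
      fun w w' hww => ?_
    refine inner_eq_zero_of_mem_eigenspace hA (fun h => hww ?_) (hφ w) (hφ w')
    exact Subtype.ext (by rw [← hre w, ← hre w', h])
  exact not_finite_iff_infinite.mpr this hv.finite_of_isNoetherian

/-! ### Transport of subspaces along `J n` -/

section Convergence

variable {H : Type*} [NormedAddCommGroup H] [InnerProductSpace ℂ H] [CompleteSpace H]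
  {K : ℕ → Type*} [∀ n, NormedAddCommGroup (K n)] [∀ n, InnerProductSpace ℂ (K n)]
  [∀ n, CompleteSpace (K n)]

theorem tendsto_norm_sq_of_adjoint_comp {J : ∀ n, H →L[ℂ] K n} {ψ : H}
    (hJ : Tendsto (fun n => ContinuousLinearMap.adjoint (J n) (J n ψ)) atTop (𝓝 ψ)) :
    Tendsto (fun n => ‖J n ψ‖ ^ 2) atTop (𝓝 (‖ψ‖ ^ 2)) := by
  have h1 : Tendsto (fun n => (⟪ContinuousLinearMap.adjoint (J n) (J n ψ), ψ⟫_ℂ).re) atTop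
      (𝓝 (⟪ψ, ψ⟫_ℂ).re) :=
    (Complex.continuous_re.tendsto _).comp (hJ.inner tendsto_const_nhds)
  have h2 : (⟪ψ, ψ⟫_ℂ).re = ‖ψ‖ ^ 2 := inner_self_eq_norm_sq (𝕜 := ℂ) ψ
  rw [h2] at h1
  refine h1.congr fun n => ?_
  rw [ContinuousLinearMap.adjoint_inner_left]
  exact inner_self_eq_norm_sq (𝕜 := ℂ) (J n ψ)

/-- For non-real `z`, generalized strong resolvent convergence implies `Rₙ Jₙ - Jₙ R → 0`
strongly. -/
theorem tendsto_resolvent_comp_sub {A : H →ₗ.[ℂ] H} {An : ∀ n, K n →ₗ.[ℂ] K n}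
    {J : ∀ n, H →L[ℂ] K n} (hA : IsSelfAdjoint A) (hAn : ∀ n, IsSelfAdjoint (An n)) {z : ℂ}
    (hz : z.im ≠ 0) {R : H →L[ℂ] H} {Rn : ∀ n, K n →L[ℂ] K n} (hR : IsResolventAt A z R)
    (hRn : ∀ n, IsResolventAt (An n) z (Rn n))
    (hJ : ∀ ψ, Tendsto (fun n => ContinuousLinearMap.adjoint (J n) (J n ψ)) atTop (𝓝 ψ)) {ψ : H}
    (hconv : Tendsto (fun n => ContinuousLinearMap.adjoint (J n) (Rn n (J n ψ))) atTop
      (𝓝 (R ψ))) :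
    Tendsto (fun n => ‖Rn n (J n ψ) - J n (R ψ)‖) atTop (𝓝 0) := by
  -- `Im ⟪χ, Rn χ⟫ = Im z ‖Rn χ‖²` turns weak information into convergence of norms; expanding the
  -- squared norm of the difference then finishes.
  have h1 : Tendsto (fun n => ‖Rn n (J n ψ)‖ ^ 2) atTop (𝓝 (‖R ψ‖ ^ 2)) := by
    have h2 : Tendsto
        (fun n => (⟪ψ, ContinuousLinearMap.adjoint (J n) (Rn n (J n ψ))⟫_ℂ).im / z.im) atTop
        (𝓝 ((⟪ψ, R ψ⟫_ℂ).im / z.im)) :=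
      ((Complex.continuous_im.tendsto _).comp (tendsto_const_nhds.inner hconv)).div_const _
    rw [hR.inner_im hA, mul_div_cancel_left₀ _ hz] at h2
    refine h2.congr fun n => ?_
    rw [ContinuousLinearMap.adjoint_inner_right, (hRn n).inner_im (hAn n),
      mul_div_cancel_left₀ _ hz]
  have h3 : Tendsto (fun n => (⟪Rn n (J n ψ), J n (R ψ)⟫_ℂ).re) atTop (𝓝 (‖R ψ‖ ^ 2)) := by
    have h4 : (⟪R ψ, R ψ⟫_ℂ).re = ‖R ψ‖ ^ 2 := inner_self_eq_norm_sq (𝕜 := ℂ) (R ψ)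
    rw [← h4]
    refine ((Complex.continuous_re.tendsto _).comp (hconv.inner tendsto_const_nhds)).congr
      fun n => ?_
    rw [Function.comp_apply, ContinuousLinearMap.adjoint_inner_left]
  have h5 := tendsto_norm_sq_of_adjoint_comp (hJ (R ψ))
  have h6 : Tendsto (fun n => ‖Rn n (J n ψ) - J n (R ψ)‖ ^ 2) atTop (𝓝 0) := by
    have h7 := (h1.sub (h3.const_mul 2)).add h5
    rw [show ‖R ψ‖ ^ 2 - 2 * ‖R ψ‖ ^ 2 + ‖R ψ‖ ^ 2 = 0 by ring] at h7
    refine h7.congr fun n => ?_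
    rw [norm_sub_sq (𝕜 := ℂ)]
    rfl
  have h8 := (Real.continuous_sqrt.tendsto 0).comp h6
  rw [Real.sqrt_zero] at h8
  refine h8.congr fun n => ?_
  rw [Function.comp_apply, Real.sqrt_sq (norm_nonneg _)]

/-- Pointwise convergence on an orthonormal basis is uniform on the unit ball. -/
theorem eventually_norm_le_of_finiteDimensional {W : Type*} [NormedAddCommGroup W]
    [InnerProductSpace ℂ W] [FiniteDimensional ℂ W] {F : ℕ → Type*}
    [∀ n, NormedAddCommGroup (F n)] [∀ n, NormedSpace ℂ (F n)] (L : ∀ n, W →ₗ[ℂ] F n)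
    (hL : ∀ w, Tendsto (fun n => ‖L n w‖) atTop (𝓝 0)) {η : ℝ} (hη : 0 < η) :
    ∀ᶠ n in atTop, ∀ w, ‖L n w‖ ≤ η * ‖w‖ := by
  let b := stdOrthonormalBasis ℂ W
  have h1 : Tendsto (fun n => ∑ i, ‖L n (b i)‖) atTop (𝓝 0) := by
    have := tendsto_finsetSum Finset.univ fun i _ => hL (b i)
    simpa using this
  filter_upwards [h1.eventually_lt_const hη] with n hn w
  have h2 : L n w = ∑ i, ⟪b i, w⟫_ℂ • L n (b i) := by
    conv_lhs => rw [← b.sum_repr' w]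
    rw [map_sum]
    simp only [map_smul]
  rw [h2]
  calc ‖∑ i, ⟪b i, w⟫_ℂ • L n (b i)‖ ≤ ∑ i, ‖⟪b i, w⟫_ℂ • L n (b i)‖ := norm_sum_le _ _
    _ ≤ ∑ i, ‖w‖ * ‖L n (b i)‖ := by
        refine Finset.sum_le_sum fun i _ => ?_
        rw [norm_smul]
        have h3 : ‖⟪b i, w⟫_ℂ‖ ≤ ‖w‖ := by
          simpa [b.norm_eq_one i] using norm_inner_le_norm (𝕜 := ℂ) (b i) w
        gcongr
    _ = (∑ i, ‖L n (b i)‖) * ‖w‖ := by rw [← Finset.mul_sum, mul_comm]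
    _ ≤ η * ‖w‖ := by gcongr

theorem abs_norm_sq_sub_norm_sq_le {F : Type*} [NormedAddCommGroup F] [InnerProductSpace ℂ F]
    [CompleteSpace F] (J : H →L[ℂ] F) (v : H) :
    |‖J v‖ ^ 2 - ‖v‖ ^ 2| ≤ ‖ContinuousLinearMap.adjoint J (J v) - v‖ * ‖v‖ := by
  have h1 : ‖J v‖ ^ 2 - ‖v‖ ^ 2 = (⟪ContinuousLinearMap.adjoint J (J v) - v, v⟫_ℂ).re := by
    rw [inner_sub_left, ContinuousLinearMap.adjoint_inner_left, Complex.sub_re]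
    exact congrArg₂ _ (inner_self_eq_norm_sq (𝕜 := ℂ) (J v)).symm
      (inner_self_eq_norm_sq (𝕜 := ℂ) v).symm
  rw [h1]
  exact (Complex.abs_re_le_norm _).trans (norm_inner_le_norm _ _)

theorem le_dimRan_of_injective {H : Type*} [NormedAddCommGroup H] [InnerProductSpace ℂ H]
    {W : Type*} [AddCommGroup W] [Module ℂ W] [FiniteDimensional ℂ W] (T : H →L[ℂ] H)
    (S : W →ₗ[ℂ] H) (hS : Function.Injective (fun w => T (S w))) :
    (Module.finrank ℂ W : ℕ∞) ≤ dimRan T := by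
  let f : W →ₗ[ℂ] LinearMap.range (T : H →ₗ[ℂ] H) :=
    ((T : H →ₗ[ℂ] H).rangeRestrict) ∘ₗ S
  have hf : Function.Injective f := fun x y hxy => hS (congrArg Subtype.val hxy)
  rw [dimRan, Cardinal.natCast_le_toENat, Module.le_rank_iff]
  exact ⟨_, (Module.finBasis ℂ W).linearIndependent.map' f (LinearMap.ker_eq_bot.mpr hf)⟩

theorem exists_submodule_finrank_eq {H : Type*} [NormedAddCommGroup H]
    [InnerProductSpace ℂ H] {V : Submodule ℂ H} (hV : ¬ FiniteDimensional ℂ V) (k : ℕ) :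
    ∃ W : Submodule ℂ H, W ≤ V ∧ FiniteDimensional ℂ W ∧ Module.finrank ℂ W = k := by
  have h1 : (k : Cardinal) ≤ Module.rank ℂ V := by
    refine (Cardinal.natCast_lt_aleph0 (n := k)).le.trans (not_lt.mp fun h => hV ?_)
    exact Module.rank_lt_aleph0_iff.mp h
  obtain ⟨f, hf⟩ := Module.le_rank_iff_exists_linearMap.mp h1
  refine ⟨LinearMap.range (V.subtype ∘ₗ f), ?_, inferInstance, ?_⟩
  · rintro _ ⟨x, rfl⟩
    exact (f x).2
  · rw [LinearMap.finrank_range_of_inj (f := V.subtype ∘ₗ f)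
    (Subtype.val_injective.comp hf), Module.finrank_fin_fun]

end Convergence

theorem eventually_finrank_le_dimRan
    {H : Type*} [NormedAddCommGroup H] [InnerProductSpace ℂ H] [CompleteSpace H]
    {K : ℕ → Type*} [∀ n, NormedAddCommGroup (K n)] [∀ n, InnerProductSpace ℂ (K n)]
    [∀ n, CompleteSpace (K n)]
    {A : H →ₗ.[ℂ] H} {An : ∀ n, K n →ₗ.[ℂ] K n} {J : ∀ n, H →L[ℂ] K n}
    (hAn : ∀ n, IsSelfAdjoint (An n))
    (hJ : ∀ ψ, Tendsto (fun n => ‖ContinuousLinearMap.adjoint (J n) (J n ψ) - ψ‖) atTop (𝓝 0))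
    {z : ℂ} {R : H →L[ℂ] H} {Rn : ∀ n, K n →L[ℂ] K n} (hR : IsResolventAt A z R)
    (hRn : ∀ n, IsResolventAt (An n) z (Rn n))
    (hconv : ∀ ψ, Tendsto (fun n => ‖Rn n (J n ψ) - J n (R ψ)‖) atTop (𝓝 0))
    {l ε : ℝ} (hε : 0 < ε) (W : Submodule ℂ H) [FiniteDimensional ℂ W] (hW : W ≤ A.domain)
    (hAW : ∀ ψ (h : ψ ∈ W), ‖A ⟨ψ, hW h⟩ - (l : ℂ) • ψ‖ ≤ ε / 2 * ‖ψ‖) :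
    ∀ᶠ n in atTop, (Module.finrank ℂ W : ℕ∞) ≤
      dimRan (spectralProjection (An n) (Set.Ioo (l - ε) (l + ε))) := by
  let AW : W →ₗ[ℂ] H := A.toFun ∘ₗ Submodule.inclusion hW
  let B : ℂ → W →ₗ[ℂ] H := fun m => AW - m • W.subtype
  have hB : ∀ m w, B m w = A ⟨w, hW w.2⟩ - m • (w : H) := fun m w => rfl
  have hRB : ∀ w, R (B z w) = w := fun w => hR.2 ⟨w, hW w.2⟩
  let S : ∀ n, W →ₗ[ℂ] K n := fun n => (Rn n : K n →ₗ[ℂ] K n) ∘ₗ (J n : H →ₗ[ℂ] K n) ∘ₗ B z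
  let JJ : ∀ n, H →ₗ[ℂ] H := fun n =>
    (ContinuousLinearMap.adjoint (J n) : K n →ₗ[ℂ] H) ∘ₗ (J n : H →ₗ[ℂ] K n) - LinearMap.id
  -- The first bound controls `S n - J n` itself, the second its multiple by `z - l`.
  have hc : 0 < min (1 / 8) (ε / (16 * (‖z - l‖ + 1))) := by positivity
  have hev1 := eventually_norm_le_of_finiteDimensional
    (fun n => S n - (J n : H →ₗ[ℂ] K n) ∘ₗ W.subtype)
    (fun w => by
      refine (hconv (B z w)).congr fun n => ?_
      rw [hRB]
      rfl) hc
  have hev2 := eventually_norm_le_of_finiteDimensional (fun n => JJ n ∘ₗ W.subtype)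
    (fun w => hJ w) (η := 1 / 8) (by norm_num)
  have hev3 := eventually_norm_le_of_finiteDimensional (fun n => JJ n ∘ₗ B l)
    (fun w => hJ (B l w)) (η := ε / 8) (by positivity)
  filter_upwards [hev1, hev2, hev3] with n h1 h2 h3
  obtain ⟨E, hE, hproj⟩ := exists_spectralProjection_eq (hAn n)
  rw [hproj]
  have hinj : Function.Injective
      ((E.proj (Set.Ioo (l - ε) (l + ε)) : K n →ₗ[ℂ] K n) ∘ₗ S n) := by
    rw [injective_iff_map_eq_zero]
    intro w hw
    by_contra hw0
    have hwpos : 0 < ‖w‖ := norm_pos_iff.mpr hw0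
    have hw' : E.proj (Set.Ioo (l - ε) (l + ε)) (S n w) = 0 := hw
    obtain ⟨hdom, hAS⟩ := (hRn n).1 (J n (B z w))
    have hlow : ε * ‖S n w‖ ≤ ‖An n ⟨S n w, hdom⟩ - (l : ℂ) • S n w‖ := by
      have h4 := hE.mul_norm_sub_proj_le (m := l) hε.le measurableSet_Ioo
        (Ω := Set.Ioo (l - ε) (l + ε)) (fun x hx => by
          by_contra h
          rw [not_le, abs_lt] at h
          exact hx ⟨by linarith [h.1], by linarith [h.2]⟩) ⟨S n w, hdom⟩
      simpa only [hw', sub_zero] using h4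
    -- From `(An n - z) S n w = J n (A - z) w`, replacing `z` by `l` on both sides costs only `(z -
    -- l) (S n w - J n w)`.
    have heq : An n ⟨S n w, hdom⟩ - (l : ℂ) • S n w =
        J n (B l w) + (z - l) • (S n w - J n (w : H)) := by
      have h5 : An n ⟨S n w, hdom⟩ = J n (B z w) + z • S n w := sub_eq_iff_eq_add.mp hAS
      have h6 : B l w = B z w + (z - l) • (w : H) := by
        rw [hB, hB, sub_smul]; abel
      rw [h5, h6, map_add, map_smul]
      module
    have h1w : ‖S n w - J n (w : H)‖ ≤ min (1 / 8) (ε / (16 * (‖z - l‖ + 1))) * ‖w‖ := h1 w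
    have hdiff : ‖S n w - J n (w : H)‖ ≤ 1 / 8 * ‖w‖ :=
      h1w.trans (by gcongr; exact min_le_left _ _)
    have hdiff' : ‖z - l‖ * ‖S n w - J n (w : H)‖ ≤ ε / 16 * ‖w‖ := by
      have h7 : ‖S n w - J n (w : H)‖ ≤ ε / (16 * (‖z - l‖ + 1)) * ‖w‖ :=
        h1w.trans (by gcongr; exact min_le_right _ _)
      calc ‖z - l‖ * ‖S n w - J n (w : H)‖
          ≤ (‖z - l‖ + 1) * (ε / (16 * (‖z - l‖ + 1)) * ‖w‖) := by gcongr; linarith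
        _ = ε / 16 * ‖w‖ := by field_simp
    have hJlow : 7 / 8 * ‖w‖ ≤ ‖J n (w : H)‖ := by
      refine (sq_le_sq₀ (by positivity) (norm_nonneg _)).mp ?_
      have h8 := abs_norm_sq_sub_norm_sq_le (J n) (w : H)
      have h9 : ‖ContinuousLinearMap.adjoint (J n) (J n (w : H)) - w‖ ≤ 1 / 8 * ‖w‖ := h2 w
      have h10 := mul_le_mul_of_nonneg_right h9 (norm_nonneg (w : H))
      rw [Submodule.coe_norm] at *
      have h11 := (abs_le.mp h8).1
      nlinarith [sq_nonneg ‖(w : H)‖]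
    -- Squared, the bound is `(1/4 + 1/16) ε² ≤ (5/8 ε)²`.
    have hJup : ‖J n (B l w)‖ ≤ 5 / 8 * ε * ‖w‖ := by
      refine (sq_le_sq₀ (norm_nonneg _) (by positivity)).mp ?_
      have h8 := abs_norm_sq_sub_norm_sq_le (J n) (B l w)
      have h9 : ‖ContinuousLinearMap.adjoint (J n) (J n (B l w)) - B l w‖ ≤ ε / 8 * ‖w‖ := h3 w
      have h12 : ‖B l w‖ ≤ ε / 2 * ‖w‖ := hAW w w.2
      have h10 := mul_le_mul h9 h12 (norm_nonneg _) (by positivity)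
      have h11 := (abs_le.mp h8).2
      have h13 := pow_le_pow_left₀ (norm_nonneg _) h12 2
      nlinarith [sq_nonneg (ε * ‖w‖)]
    have hup : ‖An n ⟨S n w, hdom⟩ - (l : ℂ) • S n w‖ ≤ 5 / 8 * ε * ‖w‖ + ε / 16 * ‖w‖ := by
      rw [heq]
      refine (norm_add_le _ _).trans ?_
      rw [norm_smul]
      exact add_le_add hJup hdiff'
    have hSlow : 3 / 4 * ‖w‖ ≤ ‖S n w‖ := by
      have h14 := norm_sub_norm_le (J n (w : H)) (S n w)
      rw [norm_sub_rev] at h14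
      linarith
    -- The contradiction is `3/4 ε ‖w‖ ≤ (5/8 + 1/16) ε ‖w‖` with `w ≠ 0`.
    have h15 := mul_le_mul_of_nonneg_left hSlow hε.le
    have h16 : 0 < ε * ‖w‖ := by positivity
    linarith
  exact le_dimRan_of_injective _ (S n) hinj

end UnboundedOp

theorem mainTheorem10
    {H : Type*} [NormedAddCommGroup H] [InnerProductSpace ℂ H] [CompleteSpace H]
    [TopologicalSpace.SeparableSpace H]
    {K : ℕ → Type*} [∀ n, NormedAddCommGroup (K n)] [∀ n, InnerProductSpace ℂ (K n)]
    [∀ n, CompleteSpace (K n)] [∀ n, TopologicalSpace.SeparableSpace (K n)]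
    (A : H →ₗ.[ℂ] H) (An : ∀ n, K n →ₗ.[ℂ] K n) (J : ∀ n, H →L[ℂ] K n)
    (hA : IsSelfAdjoint A) (hAn : ∀ n, IsSelfAdjoint (An n))
    (hconv : UnboundedOp.GeneralizedStrongResolventConvergence A An J)
    (l : ℝ) (hl : (l : ℂ) ∈ UnboundedOp.essentialSpectrum A)
    (ε : ℝ) (hε : 0 < ε) :
    Tendsto
      (fun n => UnboundedOp.dimRan
        (UnboundedOp.spectralProjection (An n) (Set.Ioo (l - ε) (l + ε))))
      atTop (𝓝 (⊤ : ℕ∞)) := by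
  obtain ⟨-, hJ, z, hz, hconvz, hreal⟩ := hconv
  have hz' : z ∉ UnboundedOp.spectrum A ∪ ⋃ n, UnboundedOp.spectrum (An n) :=
    fun h => hz (subset_closure h)
  have hR : UnboundedOp.IsResolventAt A z (UnboundedOp.resolvent A z) :=
    UnboundedOp.isResolventAt_resolvent (not_not.mp fun h => hz' (Or.inl h))
  have hRn : ∀ n, UnboundedOp.IsResolventAt (An n) z (UnboundedOp.resolvent (An n) z) := fun n =>
    UnboundedOp.isResolventAt_resolvent
      (not_not.mp fun h => hz' (Or.inr (Set.mem_iUnion.mpr ⟨n, h⟩)))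
  have hstrong : ∀ ψ, Tendsto (fun n => ‖UnboundedOp.resolvent (An n) z (J n ψ) -
      J n (UnboundedOp.resolvent A z ψ)‖) atTop (𝓝 0) := by
    by_cases him : z.im = 0
    · exact hreal him
    · exact fun ψ => UnboundedOp.tendsto_resolvent_comp_sub hA hAn him hR hRn
        (fun φ => tendsto_iff_norm_sub_tendsto_zero.mpr (hJ φ))
        (tendsto_iff_norm_sub_tendsto_zero.mpr (hconvz ψ))
  obtain ⟨E, hE⟩ := UnboundedOp.exists_represents hA
  -- Half the radius leaves the room that absorbs the errors of the transport.
  have hinf := UnboundedOp.not_finiteDimensional_range_proj hA hE hl (half_pos hε)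
  have hfix : ∀ ψ ∈ LinearMap.range (E.proj (Set.Ioo (l - ε / 2) (l + ε / 2)) : H →ₗ[ℂ] H),
      E.proj (Set.Ioo (l - ε / 2) (l + ε / 2)) ψ = ψ := by
    rintro _ ⟨φ, rfl⟩
    exact (E.isProjectionOf measurableSet_Ioo).apply_apply φ
  rw [ENat.tendsto_nhds_top_iff_natCast_lt]
  intro k
  -- Dimension `k + 1` gives the strict inequality that convergence to `⊤` asks for.
  obtain ⟨W, hWV, hWfin, hWk⟩ := UnboundedOp.exists_submodule_finrank_eq hinf (k + 1)
  have hev := UnboundedOp.eventually_finrank_le_dimRan hAn hJ hR hRn hstrong hε W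
    (fun ψ h => hE.mem_domain_of_proj_eq (hfix ψ (hWV h)))
    (fun ψ h => hE.norm_sub_le_of_proj_eq (half_pos hε).le ⟨ψ, _⟩ (hfix ψ (hWV h)))
  filter_upwards [hev] with n hn
  rw [hWk] at hn
  exact lt_of_lt_of_le (by exact_mod_cast Nat.lt_succ_self k) hn
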